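/- Let $n\ge 1$, $s\in(0,1)$ and $\max\{1,\frac{2n}{n+2s}\}<p<2$. Write $J_p(t)=|t|^{p-2}t$, $p'=\frac{p}{p-1}$, $d\mu=|x-y|^{-n-sp}\,dx\,dy$ and, for open $A\subset\mathbb{R}^n$, $$[u]^p_{W^{s,p}(A)}=\iint_{A\times A}|u(x)-u(y)|^p\,d\mu,\qquad \|u\|^p_{W^{s,p}(A)}=[u]^p_{W^{s,p}(A)}+\|u\|^p_{L^p(A)}.$$ Let $W^{s,p}_0(\Omega)$ be the closure of $C_0^\infty(\Omega)$ in the norm of $W^{s,p}(\mathbb{R}^n)$, let $L^{p-1}_{sp}(\mathbb{R}^n)$ be the space of functions with $\int_{\mathbb{R}^n}\frac{|u|^{p-1}}{1+|x|^{n+sp}}\,dx<\infty$, and for bounded open sets $\Omega\Subset\Omega'$ let $$X^{s,p}_0(\Omega,\Omega')=\{v\in W^{s,p}(\Omega')\cap L^{p-1}_{sp}(\mathbb{R}^n): v=0 \text{ a.e. on } \mathbb{R}^n\setminus\Omega\},$$ with the norm of $W^{s,p}(\Omega')$. A weak solution of $u_t+(-\Delta_p)^su=f$ in $\Omega\times(0,\infty)$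 is a function $u$ such that, for every interval $J=[T_0,T_1]\subset(0,\infty)$, $u\in L^p(J;W^{s,p}(\Omega'))\cap L^{p-1}(J;L^{p-1}_{sp}(\mathbb{R}^n))\cap C(J;L^2(\Omega))$ and $$-\int_J\int_\Omega u\,\partial_t\phi\,dx\,dt+\int_J\iint_{\mathbb{R}^n\times\mathbb{R}^n}J_p(u(x,t)-u(y,t))(\phi(x,t)-\phi(y,t))\,d\mu\,dt$$ $$=\int_\Omega u(x,T_0)\phi(x,T_0)\,dx-\int_\Omega u(x,T_1)\phi(x,T_1)\,dx+\int_J\langle f(\cdot,t),\phi(\cdot,t)\rangle\,dt$$ for all $\phi\in L^p(J;X^{s,p}_0(\Omega,\Omega'))\cap C^1(J;L^2(\Omega))$. **Proposition.** Let $\Omega\subset\mathbb{R}^n$ be a bounded domain, $\Omega'$ a bounded open set with $\Omega\Subset\Omega'$, $f\in L^{p'}_{\rm loc}((0,\infty);(X^{s,p}_0(\Omega,\Omega'))^*)$, and let $u,v$ be weak solutions of $u_t+(-\Delta_p)^su=f$ in $\Omega\times(0,\infty)$ with $u,v\in L^\infty_{\rm loc}((0,\infty);W^{s,p}(\mathbb{R}^n))$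 and $w=u-v\in L^p_{\rm loc}((0,\infty);W^{s,p}_0(\Omega))$. Let $T>0$, $t_2\in(T,\frac{3T}{2})$ and $$L=\Big[\operatorname*{ess\,sup}_{\frac T2\le\tau\le t_2}\big([v(\cdot,\tau)]_{W^{s,p}(\mathbb{R}^n)}+[u(\cdot,\tau)]_{W^{s,p}(\mathbb{R}^n)}\big)\Big]^{p-2}\in(0,\infty].$$ (i) If $sp<n$ and $\nu=\frac{2n}{n+2s}$, then $$\sup_{T\le t\le t_2}\|w(\cdot,t)\|^2_{L^\infty(\Omega)}\le C\,\frac{T^{\frac{(2-p)\nu-2p}{2(p-\nu)}}}{L^{\frac{p\nu}{2(p-\nu)}}}\int_{T/2}^{t_2}\int_\Omega|w|^2\,dx\,dt$$ with a constant $C=C(n,p,s)$. (ii) If $n\le sp<N$, where $N$ is a real number such that $\nu=\frac{2N}{N+2s}$ satisfies $\nu<p$, then the same estimate holds with this $\nu$ and a constant $C=C(\Omega,n,p,s,N)$. (If $L=\infty$, the right-hand side is read as $0$.) -/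

import Mathlib

open MeasureTheory Set Filter
open scoped ENNReal

noncomputable section

namespace FracPLap

/-- The Euclidean space `ℝⁿ`. -/
abbrev E (n : ℕ) : Type := EuclideanSpace ℝ (Fin n)

variable {n : ℕ}

/-- `J_p(t) = |t|^{p-2} t`. -/
def Jp (p t : ℝ) : ℝ := |t| ^ (p - 2) * t

/-- The measure `dμ = |x - y|^{-n-sp} dx dy` on `ℝⁿ × ℝⁿ`. -/
def dmu (n : ℕ) (s p : ℝ) : Measure (E n × E n) :=
  (volume : Measure (E n × E n)).withDensity
    (fun z => ENNReal.ofReal (‖z.1 - z.2‖ ^ (-((n : ℝ) + s * p))))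

/-- The Sobolev-Slobodeckii seminorm
`[u]_{W^{s,p}(A)} = (∫_A ∫_A |u(x) - u(y)|^p |x - y|^{-n-sp} dx dy)^{1/p}`. -/
def gagliardo (s p : ℝ) (A : Set (E n)) (u : E n → ℝ) : ℝ≥0∞ :=
  eLpNorm (fun z : E n × E n => u z.1 - u z.2) (ENNReal.ofReal p)
    ((dmu n s p).restrict (A ×ˢ A))

/-- The norm of `W^{s,p}(A)`: `‖u‖^p = [u]^p_{W^{s,p}(A)} + ‖u‖^p_{L^p(A)}`. -/
def sobolevNorm (s p : ℝ) (A : Set (E n)) (u : E n → ℝ) : ℝ≥0∞ :=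
  (gagliardo s p A u ^ p
    + eLpNorm u (ENNReal.ofReal p) (volume.restrict A) ^ p) ^ (1 / p)

/-- `u ∈ W^{s,p}(A)`. -/
def MemW (s p : ℝ) (A : Set (E n)) (u : E n → ℝ) : Prop :=
  MemLp u (ENNReal.ofReal p) (volume.restrict A) ∧
    MemLp (fun z : E n × E n => u z.1 - u z.2) (ENNReal.ofReal p)
      ((dmu n s p).restrict (A ×ˢ A))

/-- `u ∈ W^{s,p}_0(Ω)`, the closure of `C_0^∞(Ω)` in the norm of `W^{s,p}(ℝⁿ)`. -/
def MemW0 (s p : ℝ) (Ω : Set (E n)) (u : E n → ℝ) : Prop :=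
  MemW s p univ u ∧
    ∀ ε : ℝ≥0∞, 0 < ε → ∃ φ : E n → ℝ, ContDiff ℝ ((⊤ : ℕ∞) : WithTop ℕ∞) φ ∧ HasCompactSupport φ ∧
      tsupport φ ⊆ Ω ∧ sobolevNorm s p univ (fun x => u x - φ x) < ε

/-- The weighted measure `(1 + |x|^{n+α})^{-1} dx` on `ℝⁿ`. -/
def tailMeasure (n : ℕ) (α : ℝ) : Measure (E n) :=
  (volume : Measure (E n)).withDensity
    (fun x => ENNReal.ofReal (1 / (1 + ‖x‖ ^ ((n : ℝ) + α))))

/-- `u` belongs to the tail space `L^q_α(ℝⁿ)`.  Local `q`-integrability is contained in this, as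
the weight is bounded below on bounded sets. -/
def MemTail (q α : ℝ) (u : E n → ℝ) : Prop :=
  MemLp u (ENNReal.ofReal q) (tailMeasure n α)

/-- The norm of the tail space `L^q_α(ℝⁿ)`. -/
def tailNorm (q α : ℝ) (u : E n → ℝ) : ℝ≥0∞ :=
  eLpNorm u (ENNReal.ofReal q) (tailMeasure n α)

/-- `X_0^{s,p}(Ω, Ω')`: functions in `W^{s,p}(Ω') ∩ L^{p-1}_{sp}(ℝⁿ)` that vanish almost everywhere
outside `Ω`.  It carries the norm of `W^{s,p}(Ω')`. -/
def X0 (s p : ℝ) (Ω Ω' : Set (E n)) : Submodule ℝ (E n → ℝ) where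
  carrier := {v | MemW s p Ω' v ∧ MemTail (p - 1) (s * p) v ∧
    v =ᵐ[volume.restrict Ωᶜ] 0}
  zero_mem' := by
    refine ⟨⟨MemLp.zero, ?_⟩, MemLp.zero, Filter.EventuallyEq.rfl⟩
    simp
  add_mem' := by
    rintro a b ⟨⟨h1, h2⟩, h3, h4⟩ ⟨⟨k1, k2⟩, k3, k4⟩
    refine ⟨⟨h1.add k1, ?_⟩, MemLp.add h3 k3, ?_⟩
    · convert h2.add k2 using 1
      ext z
      simp only [Pi.add_apply]
      ring
    · filter_upwards [h4, k4] with x hx kx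
      simp [hx, kx]
  smul_mem' := by
    rintro c a ⟨⟨h1, h2⟩, h3, h4⟩
    refine ⟨⟨h1.const_smul c, ?_⟩, MemLp.const_smul h3 c, ?_⟩
    · convert h2.const_smul c using 1
      ext z
      simp only [Pi.smul_apply, smul_eq_mul]
      ring
    · filter_upwards [h4] with x hx
      simp [hx]

/-- Linear functionals on `X_0^{s,p}(Ω, Ω')`; the elements of the dual space
`(X_0^{s,p}(Ω, Ω'))^*` are those with finite `dualNorm`. -/
abbrev X0Functional (s p : ℝ) (Ω Ω' : Set (E n)) : Type :=
  X0 s p Ω Ω' →ₗ[ℝ] ℝ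

/-- The norm of `(X_0^{s,p}(Ω, Ω'))^*`. -/
def dualNorm {s p : ℝ} {Ω Ω' : Set (E n)} (l : X0Functional s p Ω Ω') : ℝ≥0∞ :=
  ⨆ (v : X0 s p Ω Ω') (_ : sobolevNorm s p Ω' (v : E n → ℝ) ≤ 1), ‖l v‖ₑ

open Classical in
/-- The duality pairing `⟨l, v⟩`, for `v ∈ X_0^{s,p}(Ω, Ω')`. -/
def pairing {s p : ℝ} {Ω Ω' : Set (E n)} (l : X0Functional s p Ω Ω') (v : E n → ℝ) : ℝ :=
  if h : v ∈ X0 s p Ω Ω' then l ⟨v, h⟩ else 0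

/-- `g ∈ L^q(J; V)`, where `V` is given by its membership predicate and its norm: `g(t) ∈ V` for
a.e. `t ∈ J`, and `t ↦ ‖g(t)‖_V` is measurable on `J` and belongs to `L^q(J)`. -/
def MemLpTime {V : Type*} (mem : V → Prop) (N : V → ℝ≥0∞) (q : ℝ≥0∞) (J : Set ℝ)
    (g : ℝ → V) : Prop :=
  (∀ᵐ t ∂(volume.restrict J), mem (g t)) ∧
    AEMeasurable (fun t => N (g t)) (volume.restrict J) ∧
    eLpNorm (fun t => N (g t)) q (volume.restrict J) < ∞

/-- `g ∈ L^q_loc(I; V)`: `g ∈ L^q(J; V)` for every compact interval `J ⊆ I`. -/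
def MemLpTimeLoc {V : Type*} (mem : V → Prop) (N : V → ℝ≥0∞) (q : ℝ≥0∞) (I : Set ℝ)
    (g : ℝ → V) : Prop :=
  ∀ T₀ T₁ : ℝ, T₀ < T₁ → Icc T₀ T₁ ⊆ I → MemLpTime mem N q (Icc T₀ T₁) g

/-- `u ∈ C(J; L²(Ω))`. -/
def ContL2 (Ω : Set (E n)) (J : Set ℝ) (u : ℝ → E n → ℝ) : Prop :=
  ∃ U : ℝ → Lp ℝ 2 (volume.restrict Ω), ContinuousOn U J ∧
    ∀ t ∈ J, u t =ᵐ[volume.restrict Ω] U t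

/-- `φ ∈ C¹(J; L²(Ω))` with time derivative `∂_t φ = ψ`. -/
def C1L2 (Ω : Set (E n)) (J : Set ℝ) (φ ψ : ℝ → E n → ℝ) : Prop :=
  ∃ Φ Ψ : ℝ → Lp ℝ 2 (volume.restrict Ω), ContinuousOn Ψ J ∧
    (∀ t ∈ J, HasDerivWithinAt Φ (Ψ t) J t) ∧
    ∀ t ∈ J, φ t =ᵐ[volume.restrict Ω] Φ t ∧ ψ t =ᵐ[volume.restrict Ω] Ψ t

/-- `φ` is an admissible test function on `J` with time derivative `ψ`:
`φ ∈ L^p(J; X_0^{s,p}(Ω, Ω')) ∩ C¹(J; L²(Ω))` and `ψ = ∂_t φ`. -/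
structure IsTest (s p : ℝ) (Ω Ω' : Set (E n)) (J : Set ℝ) (φ ψ : ℝ → E n → ℝ) : Prop where
  meas : AEStronglyMeasurable (Function.uncurry φ) ((volume.restrict J).prod volume)
  memLp : MemLpTime (fun v => v ∈ X0 s p Ω Ω') (sobolevNorm s p Ω') (ENNReal.ofReal p) J φ
  memC1 : C1L2 Ω J φ ψ

/-- `u` is a weak solution of `∂_t u + (-Δ_p)^s u = f` in `Ω × I`. -/
structure IsWeakSolution (s p : ℝ) (Ω Ω' : Set (E n)) (I : Set ℝ)
    (f : ℝ → X0Functional s p Ω Ω') (u : ℝ → E n → ℝ) : Prop where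
  meas : AEStronglyMeasurable (Function.uncurry u) ((volume.restrict I).prod volume)
  memW : MemLpTimeLoc (MemW s p Ω') (sobolevNorm s p Ω') (ENNReal.ofReal p) I u
  memTail : MemLpTimeLoc (MemTail (p - 1) (s * p)) (tailNorm (p - 1) (s * p))
    (ENNReal.ofReal (p - 1)) I u
  cont : ∀ T₀ T₁ : ℝ, T₀ < T₁ → Icc T₀ T₁ ⊆ I → ContL2 Ω (Icc T₀ T₁) u
  weak : ∀ T₀ T₁ : ℝ, T₀ < T₁ → Icc T₀ T₁ ⊆ I →
    ∀ φ ψ : ℝ → E n → ℝ, IsTest s p Ω Ω' (Icc T₀ T₁) φ ψ →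
      -(∫ t in Icc T₀ T₁, ∫ x in Ω, u t x * ψ t x)
        + (∫ t in Icc T₀ T₁, ∫ z : E n × E n,
            Jp p (u t z.1 - u t z.2) * (φ t z.1 - φ t z.2) ∂(dmu n s p))
      = (∫ x in Ω, u T₀ x * φ T₀ x) - (∫ x in Ω, u T₁ x * φ T₁ x)
        + ∫ t in Icc T₀ T₁, pairing (f t) (φ t)

/-- `f ∈ L^{p'}_loc(I; (X_0^{s,p}(Ω, Ω'))^*)`, with `p' = p / (p - 1)`; the first conjunct is
the measurability of `f` (weak measurability suffices, the spaces being separable). -/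
def MemSource (s p : ℝ) (Ω Ω' : Set (E n)) (I : Set ℝ)
    (f : ℝ → X0Functional s p Ω Ω') : Prop :=
  (∀ v : X0 s p Ω Ω', AEMeasurable (fun t => f t v) (volume.restrict I)) ∧
    MemLpTimeLoc (fun l => dualNorm l < ∞) dualNorm (ENNReal.ofReal (p / (p - 1))) I f

/-- `L = (sup_{a ≤ τ ≤ b} ([v(·,τ)]_{W^{s,p}(ℝⁿ)} + [u(·,τ)]_{W^{s,p}(ℝⁿ)}))^{p-2}`.  The supremum
is the essential one: `u(·,τ)` and `v(·,τ)` lie in `W^{s,p}(ℝⁿ)` for almost every `τ` only. -/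
def Lconst (s p a b : ℝ) (u v : ℝ → E n → ℝ) : ℝ≥0∞ :=
  (essSup (fun τ => gagliardo s p univ (v τ) + gagliardo s p univ (u τ))
    (volume.restrict (Icc a b))) ^ (p - 2)

end FracPLap

end

/-!
The estimate is an `L² → L^∞` smoothing effect for the difference `w = u - v`, obtained by
De Giorgi's method for the excess `y_k(t) = ‖(w(t) - k)_+‖²` in `L²(Ω)`. Write `θ = sp / N`
(with `N = n` if `sp < n`) and `δ = 1 - 2 (1 - θ) / p`; then `ν < p` says that `δ > 0`, and
`1 / δ = pν / (2 (p - ν))` is the power of `L` (`exponents`).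

*Energy.* Subtracting the equations, tested with functions independent of time, gives
`⟨w(b) - w(a), g⟩ = -∫_a^b B(τ; g) dτ`, where `B(τ; g)` is the difference of the two nonlinear
forms. With `g = (w(b) - k)_+`, convexity bounds `y_k(b) - y_k(a)` by `-2 ∫_a^b B(τ; g) dτ`. No
regularization in time is needed: the seminorms of `u` and `v` are bounded by some `M`, so `y_k`
minus a multiple of `t` is nonincreasing, and a monotone function satisfies
`y(b) - y(a) ≤ ∫ y'` in the direction that is needed (`sub_le_integral_of_deriv_le`). Almost every
time is a Lebesgue point of `B(·; g)` for all `g` at once (`ae_forall_hasDerivAt_pairing`), which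
shows that the derivative of `y_k` is at most `-2 B(t; (w(t) - k)_+)` almost everywhere
(`EvolutionPair.deriv_excess_le`).

*Coercivity.* Strong monotonicity of `J_p` and Hölder's inequality give
`B(t; g) ≥ (p - 1) M^{p - 2} [g]²` for `g = (w(t) - k)_+` (`eLpNorm_le_sqrt_energy`); this is
where `L` comes from.

*Sobolev inequality.* Only functions `g ≥ 0` of small support are needed, in the form
`‖g‖² ≤ C |{g > 0}|^δ [g]²` (`exists_supportSobolev`). The pairs of points with `g(x) > 2l` and
`g(y) ≤ l` give `l^p |{g > 2l}| ≤ C [g]^p |{g > l}|^θ` (`level_set_le`), because the kernel has mass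
at least `κ |A|^{-θ}` outside a set `A` (`KernelBound`). If `sp ≥ n`, the exponent `sp / n` of this
bound is lowered to `sp / N` on subsets of the bounded set `Ω`, at the price of a constant
depending on `|Ω|`.

*Iteration.* Chebyshev's inequality bounds `|{w(t) > k'}|` by `y_k(a) / (k' - k)²` for `t ≥ a`, so
the three facts combine to a superlinear inequality between `y_{k'}(b)` and `y_k(a)`
(`EvolutionPair.excess_mul_le`), which is iterated (`eq_zero_of_excess_mul_le`) from the time
`3T/4`. The norm of `w(3T/4)` is bounded by the average over `[T/2, 3T/4]`. If `M` may be taken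
arbitrarily small, which is the case `L = ∞`, letting `M → 0` shows that `w` vanishes.
-/

namespace FracPLap

open scoped Topology

/-! ### Lower bounds for the kernel and comparison of level sets -/

/-- A ball about `x` of measure `2 |A|` has a part of measure at least `|A|` outside `A`, on which
the kernel is at least its value on the boundary of the ball. -/
theorem exists_kernel_lower_bound {n : ℕ} (hn : 0 < n) {r : ℝ} (hr : 0 < r) :
    ∃ κ : ℝ, 0 < κ ∧ ∀ (x : E n) (A : Set (E n)), MeasurableSet A → 0 < volume.real A →
      ENNReal.ofReal (κ * volume.real A ^ (-(r / n))) ≤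
        ∫⁻ y in Aᶜ, ENNReal.ofReal (‖x - y‖ ^ (-((n : ℝ) + r))) := by
  have : Nonempty (Fin n) := ⟨⟨0, hn⟩⟩
  have : Nontrivial (E n) := inferInstance
  have hn' : (0 : ℝ) < n := by exact_mod_cast hn
  set ω : ℝ := volume.real (Metric.ball (0 : E n) 1) with hω
  have hω0 : 0 < ω := ENNReal.toReal_pos (Metric.measure_ball_pos _ _ one_pos).ne'
    measure_ball_lt_top.ne
  refine ⟨(2 / ω) ^ (-(1 + r / n)), by positivity, fun x A hA ha => ?_⟩
  set a := volume.real A with haA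
  have hAtop : volume A ≠ ∞ := fun h => by simp [haA, measureReal_def, h] at ha
  set R : ℝ := (2 * a / ω) ^ (1 / (n : ℝ)) with hR
  have hR0 : 0 < R := by positivity
  have hRn : R ^ n = 2 * a / ω := by
    rw [hR, ← Real.rpow_natCast, ← Real.rpow_mul (by positivity),
      one_div_mul_cancel hn'.ne', Real.rpow_one]
  have hball : volume (Metric.ball x R) = ENNReal.ofReal (2 * a) := by
    rw [Measure.addHaar_ball _ _ hR0.le, finrank_euclideanSpace_fin, hRn,
      ← ENNReal.ofReal_toReal (measure_ball_lt_top (μ := volume) (x := (0 : E n)) (r := 1)).ne,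
      ← measureReal_def, ← hω, ← ENNReal.ofReal_mul (by positivity)]
    rw [div_mul_cancel₀ _ hω0.ne']
  -- the centre is removed because the real power gives the kernel the value `0` there
  set S : Set (E n) := (Metric.ball x R \ A) \ {x} with hS
  have hSvol : ENNReal.ofReal a ≤ volume S := by
    rw [hS, measure_sdiff_null (measure_singleton x)]
    refine le_trans ?_ (le_measure_sdiff)
    rw [hball, ← ENNReal.ofReal_toReal hAtop, ← measureReal_def, ← haA,
      ← ENNReal.ofReal_sub _ ha.le]
    exact ENNReal.ofReal_le_ofReal (by linarith)
  have hSm : MeasurableSet S := (measurableSet_ball.diff hA).diff (measurableSet_singleton x)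
  calc ENNReal.ofReal ((2 / ω) ^ (-(1 + r / n)) * a ^ (-(r / n)))
      = ENNReal.ofReal (R ^ (-((n : ℝ) + r))) * ENNReal.ofReal a := by
        rw [← ENNReal.ofReal_mul (by positivity)]
        congr 1
        rw [hR, ← Real.rpow_mul (by positivity), mul_div_right_comm,
          Real.mul_rpow (by positivity) ha.le, mul_assoc, ← Real.rpow_add_one ha.ne']
        congr 2
        · field_simp
        · field_simp
          ring
    _ ≤ ENNReal.ofReal (R ^ (-((n : ℝ) + r))) * volume S := by gcongr
    _ = ∫⁻ y in S, ENNReal.ofReal (R ^ (-((n : ℝ) + r))) := (setLIntegral_const _ _).symm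
    _ ≤ ∫⁻ y in S, ENNReal.ofReal (‖x - y‖ ^ (-((n : ℝ) + r))) := by
        refine setLIntegral_mono' hSm fun y hy => ENNReal.ofReal_le_ofReal ?_
        have h1 : 0 < ‖x - y‖ := by
          rw [norm_pos_iff, sub_ne_zero]
          exact fun h => hy.2 h.symm
        have h2 : ‖x - y‖ ≤ R := by
          have := hy.1.1
          rw [Metric.mem_ball, dist_comm, dist_eq_norm] at this
          exact this.le
        exact Real.rpow_le_rpow_of_nonpos h1 h2 (by linarith)
    _ ≤ _ := lintegral_mono_set fun y hy => hy.1.2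

/-- The kernel `|x - y|^{-n-sp}` has mass at least `κ |A|^{-θ}` outside every set `A` of positive
measure at most `V`, uniformly in the centre `x`. -/
def KernelBound (n : ℕ) (s p θ κ V : ℝ) : Prop :=
  ∀ (x : E n) (A : Set (E n)), MeasurableSet A → 0 < volume.real A → volume.real A ≤ V →
    ENNReal.ofReal (κ * volume.real A ^ (-θ)) ≤
      ∫⁻ y in Aᶜ, ENNReal.ofReal (‖x - y‖ ^ (-((n : ℝ) + s * p)))

theorem exists_kernelBound {n : ℕ} (hn : 0 < n) {s p : ℝ} (h : 0 < s * p) :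
    ∃ κ : ℝ, 0 < κ ∧ ∀ V, KernelBound n s p (s * p / n) κ V := by
  obtain ⟨κ, h0, h1⟩ := exists_kernel_lower_bound hn h
  exact ⟨κ, h0, fun V x A hA ha _ => h1 x A hA ha⟩

/-- On sets of bounded measure the dimension may be replaced by any larger real number `N`. -/
theorem exists_kernelBound_of_le {n : ℕ} (hn : 0 < n) {s p N V : ℝ} (h : 0 < s * p)
    (hN : (n : ℝ) ≤ N) (hV : 0 < V) :
    ∃ κ : ℝ, 0 < κ ∧ KernelBound n s p (s * p / N) κ V := by
  obtain ⟨κ, h0, h1⟩ := exists_kernel_lower_bound hn h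
  have hn' : (0 : ℝ) < n := by exact_mod_cast hn
  have hle : s * p / N ≤ s * p / n := by gcongr
  refine ⟨κ * V ^ (-(s * p / n - s * p / N)), by positivity, fun x A hA ha haV =>
    le_trans (ENNReal.ofReal_le_ofReal ?_) (h1 x A hA ha)⟩
  have : volume.real A ^ (-(s * p / n)) =
      volume.real A ^ (-(s * p / n - s * p / N)) * volume.real A ^ (-(s * p / N)) := by
    rw [← Real.rpow_add ha]
    congr 1
    ring
  rw [this, ← mul_assoc]
  have h2 : V ^ (-(s * p / n - s * p / N)) ≤ volume.real A ^ (-(s * p / n - s * p / N)) :=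
    Real.rpow_le_rpow_of_nonpos ha haV (by linarith)
  gcongr

theorem measurable_kernel (n : ℕ) (r : ℝ) :
    Measurable fun z : E n × E n => ENNReal.ofReal (‖z.1 - z.2‖ ^ r) := by
  fun_prop

theorem gagliardo_univ_rpow {n : ℕ} {s p : ℝ} (hp : 0 < p) (u : E n → ℝ) :
    gagliardo s p univ u ^ p = ∫⁻ z, ‖u z.1 - u z.2‖ₑ ^ p ∂(dmu n s p) := by
  rw [gagliardo, univ_prod_univ, Measure.restrict_univ,
    eLpNorm_eq_lintegral_rpow_enorm_toReal (by simpa using hp) (by simp),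
    ENNReal.toReal_ofReal hp.le, ← ENNReal.rpow_mul, one_div_mul_cancel hp.ne', ENNReal.rpow_one]

/-- Comparison of two superlevel sets: if `g(x) > 2λ` and `g(y) ≤ λ`, then `g(x) - g(y) > λ`. -/
theorem level_set_le {n : ℕ} {s p θ κ V : ℝ} (hp : 0 < p) (hκ : 0 < κ)
    (hK : KernelBound n s p θ κ V)
    {g : E n → ℝ} (hg : Measurable g) {l e : ℝ} (hl : 0 < l) (he : 0 < e)
    (hge : gagliardo s p univ g ≤ ENNReal.ofReal e)
    (hfin : volume {x | l < g x} ≠ ∞) (hV : volume.real {x | l < g x} ≤ V) :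
    κ * l ^ p * volume.real {x | 2 * l < g x} ≤ e ^ p * volume.real {x | l < g x} ^ θ := by
  set A := {x | l < g x} with hA
  set A₂ := {x | 2 * l < g x} with hA₂
  have hAm : MeasurableSet A := measurableSet_lt measurable_const hg
  have hA₂m : MeasurableSet A₂ := measurableSet_lt measurable_const hg
  have hsub : A₂ ⊆ A := fun x hx => by
    simp only [hA₂, hA, mem_ofPred_eq] at hx ⊢
    linarith
  rcases eq_or_lt_of_le (measureReal_nonneg : 0 ≤ volume.real A) with h0 | h0
  · have : volume.real A₂ = 0 := le_antisymm
      (h0 ▸ measureReal_mono hsub hfin) measureReal_nonneg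
    rw [this, mul_zero]
    positivity
  have hfin₂ : volume A₂ ≠ ∞ := ne_top_of_le_ne_top hfin (measure_mono hsub)
  have key : ENNReal.ofReal (κ * volume.real A ^ (-θ)) * ENNReal.ofReal (l ^ p) * volume A₂
      ≤ ENNReal.ofReal (e ^ p) := by
    calc ENNReal.ofReal (κ * volume.real A ^ (-θ)) * ENNReal.ofReal (l ^ p) * volume A₂
        = ∫⁻ x in A₂, ENNReal.ofReal (l ^ p) * ENNReal.ofReal (κ * volume.real A ^ (-θ)) := by
          rw [setLIntegral_const]
          ring
      _ ≤ ∫⁻ x in A₂, ENNReal.ofReal (l ^ p) *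
            ∫⁻ y in Aᶜ, ENNReal.ofReal (‖x - y‖ ^ (-((n : ℝ) + s * p))) := by
          refine lintegral_mono fun x => ?_
          gcongr
          exact hK x A hAm h0 hV
      _ ≤ ∫⁻ x in A₂, ∫⁻ y in Aᶜ, ENNReal.ofReal (‖x - y‖ ^ (-((n : ℝ) + s * p))) *
            ‖g x - g y‖ₑ ^ p := by
          refine setLIntegral_mono' hA₂m fun x hx => ?_
          rw [← lintegral_const_mul' _ _ ENNReal.ofReal_ne_top]
          refine setLIntegral_mono' hAm.compl fun y hy => ?_
          rw [mul_comm]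
          gcongr
          simp only [hA₂, hA, mem_ofPred_eq, mem_compl_iff, not_lt] at hx hy
          rw [Real.enorm_eq_ofReal (by linarith), ENNReal.ofReal_rpow_of_nonneg (by linarith) hp.le]
          refine ENNReal.ofReal_le_ofReal (Real.rpow_le_rpow hl.le (by linarith) hp.le)
      _ ≤ ∫⁻ x, ∫⁻ y, ENNReal.ofReal (‖x - y‖ ^ (-((n : ℝ) + s * p))) * ‖g x - g y‖ₑ ^ p :=
          (setLIntegral_le_lintegral _ _).trans
            (lintegral_mono fun x => setLIntegral_le_lintegral _ _)
      _ = gagliardo s p univ g ^ p := by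
          have hm : Measurable fun z : E n × E n => ‖g z.1 - g z.2‖ₑ ^ p := by fun_prop
          rw [gagliardo_univ_rpow hp, dmu, lintegral_withDensity_eq_lintegral_mul _
            (measurable_kernel n _) hm, Measure.volume_eq_prod, lintegral_prod]
          · rfl
          · exact ((measurable_kernel n _).mul hm).aemeasurable
      _ ≤ ENNReal.ofReal e ^ p := by gcongr
      _ = ENNReal.ofReal (e ^ p) := ENNReal.ofReal_rpow_of_nonneg he.le hp.le
  rw [← ENNReal.ofReal_toReal hfin₂, ← measureReal_def, ← ENNReal.ofReal_mul (by positivity),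
    ← ENNReal.ofReal_mul (by positivity), ENNReal.ofReal_le_ofReal_iff (by positivity)] at key
  rw [Real.rpow_neg h0.le] at key
  have hpos : 0 < volume.real A ^ θ := by positivity
  calc κ * l ^ p * volume.real A₂
      = κ * (volume.real A ^ θ)⁻¹ * l ^ p * volume.real A₂ * volume.real A ^ θ := by
        field_simp
    _ ≤ _ := by gcongr

/-! ### A Sobolev inequality for functions of small support -/

theorem sq_le_dyadic_sum {l t : ℝ} (hl : 0 < l) (ht : 0 ≤ t) :
    ENNReal.ofReal (t ^ 2) ≤ ({t | 0 < t} : Set ℝ).indicator (fun _ => ENNReal.ofReal (l ^ 2)) t +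
      ∑' j : ℕ, ({t | 2 ^ j * l < t} : Set ℝ).indicator
        (fun _ => ENNReal.ofReal (4 * l ^ 2 * 4 ^ j)) t := by
  rcases eq_or_lt_of_le ht with rfl | h0
  · simp
  rcases le_or_gt t l with h1 | h1
  · refine le_add_right ?_
    rw [indicator_of_mem (by simpa using h0)]
    exact ENNReal.ofReal_le_ofReal (by gcongr)
  · refine le_add_left ?_
    have hex : ∃ m : ℕ, t ≤ 2 ^ m * l := by
      obtain ⟨m, hm⟩ := pow_unbounded_of_one_lt (t / l) (one_lt_two : (1 : ℝ) < 2)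
      exact ⟨m, by rw [div_lt_iff₀ hl] at hm; exact hm.le⟩
    classical
    obtain ⟨j, hj⟩ : ∃ j, Nat.find hex = j + 1 := Nat.exists_eq_succ_of_ne_zero fun h => by
      have := Nat.find_spec hex
      rw [h] at this
      linarith
    have hub := Nat.find_spec hex
    have hlb : 2 ^ j * l < t := not_le.1 (Nat.find_min hex (m := j) (by lia))
    rw [hj] at hub
    refine le_trans ?_ (ENNReal.le_tsum j)
    rw [indicator_of_mem (by simpa using hlb)]
    refine ENNReal.ofReal_le_ofReal ?_
    calc t ^ 2 ≤ (2 ^ (j + 1) * l) ^ 2 := by gcongr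
      _ = 4 * l ^ 2 * 4 ^ j := by
        rw [show (4 : ℝ) = 2 ^ 2 by norm_num, ← pow_mul]
        ring

/-- A Sobolev inequality for functions of small support: if `g ≥ 0` is positive on a set of measure
at most `a` (and at most `V`), then `‖g‖²_{L²} ≤ C a^δ [g]²`. -/
def SupportSobolev (n : ℕ) (s p δ C V : ℝ) : Prop :=
  ∀ g : E n → ℝ, Measurable g → (∀ x, 0 ≤ g x) → ∀ a e : ℝ, 0 < a → 0 < e →
    volume {x | 0 < g x} ≠ ∞ → volume.real {x | 0 < g x} ≤ V →
    volume.real {x | 0 < g x} ≤ a → gagliardo s p univ g ≤ ENNReal.ofReal e →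
    ∫⁻ x, ENNReal.ofReal (g x ^ 2) ≤ ENNReal.ofReal (C * a ^ δ * e ^ 2)

/-- The kernel bound implies the Sobolev inequality for functions of small support: the doubling
relation of `level_set_le`, iterated upwards from a suitable level `l`, gives
`|{g > 2^j l}| ≤ a 2^{-jq}` with `q = p / (1 - θ) > 2`, and the dyadic decomposition of `g²`
is then summed. -/
theorem exists_supportSobolev {p θ κ : ℝ} (hp : 0 < p) (hθ₀ : 0 < θ) (hθ₁ : θ < 1)
    (hpθ : 2 < p / (1 - θ)) (hκ : 0 < κ) :
    ∃ C : ℝ, 0 < C ∧ ∀ (n : ℕ) (s V : ℝ), KernelBound n s p θ κ V →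
      SupportSobolev n s p (1 - 2 * (1 - θ) / p) C V := by
  set q := p / (1 - θ) with hq
  have h1θ : 0 < 1 - θ := by linarith
  have hqp : q * θ + p = q := by rw [hq]; field_simp; ring
  set ρ : ℝ := 2 ^ (-q) with hρ
  have hρ0 : 0 < ρ := by positivity
  have hρθ : ρ ^ θ * 2 ^ (-p) = ρ := by
    rw [hρ, ← Real.rpow_mul zero_le_two, ← Real.rpow_add zero_lt_two]
    congr 1
    linarith
  have hρ4 : 4 * ρ < 1 := by
    have : (4 : ℝ) = 2 ^ (2 : ℝ) := by norm_num
    rw [hρ, this, ← Real.rpow_add zero_lt_two]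
    exact Real.rpow_lt_one_of_one_lt_of_neg one_lt_two (by linarith)
  refine ⟨(ρ⁻¹ / κ) ^ (2 / p) * (1 + 4 * (1 - 4 * ρ)⁻¹), ?_, ?_⟩
  · have : 0 < 1 - 4 * ρ := by linarith
    positivity
  intro n s V hK g hg hg0 a e ha he hfin hV hsupp hge
  set l : ℝ := (ρ⁻¹ * e ^ p * a ^ (θ - 1) / κ) ^ (1 / p) with hl
  have hl0 : 0 < l := by positivity
  have hlp : l ^ p = ρ⁻¹ * e ^ p * a ^ (θ - 1) / κ := by
    rw [hl, ← Real.rpow_mul (by positivity), one_div_mul_cancel hp.ne', Real.rpow_one]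
  have hsub : ∀ m : ℝ, 0 < m → {x | m < g x} ⊆ {x | 0 < g x} := fun m hm x hx => hm.trans hx
  have hfin' : ∀ m : ℝ, 0 < m → volume {x | m < g x} ≠ ∞ := fun m hm =>
    ne_top_of_le_ne_top hfin (measure_mono (hsub m hm))
  have hdecay : ∀ j : ℕ, volume.real {x | 2 ^ j * l < g x} ≤ a * ρ ^ j := by
    intro j
    induction j with
    | zero =>
      simpa using (measureReal_mono (hsub l hl0) hfin).trans hsupp
    | succ j ih =>
      have hm : 0 < 2 ^ j * l := by positivity
      have h := level_set_le hp hκ hK hg hm he hge (hfin' _ hm)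
        ((measureReal_mono (hsub _ hm) hfin).trans hV)
      rw [← mul_assoc, ← pow_succ'] at h
      have h2 : e ^ p * volume.real {x | 2 ^ j * l < g x} ^ θ ≤ e ^ p * (a ^ θ * (ρ ^ θ) ^ j) := by
        have : (ρ ^ θ) ^ j = (ρ ^ j) ^ θ := by
          rw [← Real.rpow_natCast, ← Real.rpow_mul hρ0.le, mul_comm, Real.rpow_mul hρ0.le,
            Real.rpow_natCast]
        rw [this, ← Real.mul_rpow ha.le (by positivity)]
        gcongr
      have h3 : κ * (2 ^ j * l) ^ p = (2 ^ p) ^ j * (ρ⁻¹ * e ^ p * (a ^ θ / a)) := by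
        rw [Real.mul_rpow (by positivity) hl0.le, hlp, Real.rpow_sub_one ha.ne',
          ← Real.rpow_natCast, ← Real.rpow_natCast (2 ^ p), ← Real.rpow_mul zero_le_two,
          ← Real.rpow_mul zero_le_two, mul_comm (j : ℝ) p]
        field_simp
      rw [h3] at h
      have h2p : (2 : ℝ) ^ (-p) = (2 ^ p)⁻¹ := Real.rpow_neg zero_le_two p
      have hρθ' : ρ ^ θ = ρ * 2 ^ p := by
        rw [h2p] at hρθ
        exact (mul_inv_eq_iff_eq_mul₀ (by positivity)).1 hρθ
      rw [hρθ'] at h2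
      have h4 := h.trans h2
      have h5 : (2 ^ p) ^ j * (ρ⁻¹ * e ^ p * (a ^ θ / a)) * (a * ρ ^ (j + 1)) =
          e ^ p * (a ^ θ * (ρ * 2 ^ p) ^ j) := by
        rw [mul_pow, pow_succ]
        field_simp
      rw [← h5] at h4
      exact le_of_mul_le_mul_left h4 (by positivity)
  have hvol : ∀ j : ℕ, volume {x | 2 ^ j * l < g x} ≤ ENNReal.ofReal (a * ρ ^ j) := fun j => by
    rw [← ENNReal.ofReal_toReal (hfin' (2 ^ j * l) (by positivity))]
    exact ENNReal.ofReal_le_ofReal (hdecay j)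
  have hvol0 : volume {x | 0 < g x} ≤ ENNReal.ofReal a := by
    rw [← ENNReal.ofReal_toReal hfin]
    exact ENNReal.ofReal_le_ofReal hsupp
  have hmeas : ∀ m : ℝ, MeasurableSet {t : ℝ | m < t} := fun m => measurableSet_Ioi
  have hind : ∀ (m : ℝ) (c : ℝ≥0∞), ∫⁻ x, ({t | m < t} : Set ℝ).indicator (fun _ => c) (g x) =
      c * volume {x | m < g x} := fun m c => by
    exact lintegral_indicator_const (hg (hmeas m)) c
  calc ∫⁻ x, ENNReal.ofReal (g x ^ 2)
      ≤ ∫⁻ x, (({t | 0 < t} : Set ℝ).indicator (fun _ => ENNReal.ofReal (l ^ 2)) (g x) +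
        ∑' j : ℕ, ({t | 2 ^ j * l < t} : Set ℝ).indicator
          (fun _ => ENNReal.ofReal (4 * l ^ 2 * 4 ^ j)) (g x)) :=
        lintegral_mono fun x => sq_le_dyadic_sum hl0 (hg0 x)
    _ = ENNReal.ofReal (l ^ 2) * volume {x | 0 < g x} +
        ∑' j : ℕ, ENNReal.ofReal (4 * l ^ 2 * 4 ^ j) * volume {x | 2 ^ j * l < g x} := by
        have hm : ∀ (m : ℝ) (c : ℝ≥0∞),
            Measurable fun x => ({t | m < t} : Set ℝ).indicator (fun _ => c) (g x) :=
          fun m c => (measurable_const.indicator (hmeas m)).comp hg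
        rw [lintegral_add_left (hm 0 _), lintegral_tsum fun j => (hm _ _).aemeasurable, hind]
        simp_rw [hind]
    _ ≤ ENNReal.ofReal (l ^ 2) * ENNReal.ofReal a +
        ∑' j : ℕ, ENNReal.ofReal (4 * l ^ 2 * 4 ^ j) * ENNReal.ofReal (a * ρ ^ j) := by
        gcongr with j
        exact hvol j
    _ = ENNReal.ofReal (l ^ 2 * a) + ENNReal.ofReal (∑' j : ℕ, 4 * (l ^ 2 * a) * (4 * ρ) ^ j) := by
        rw [ENNReal.ofReal_tsum_of_nonneg (fun j => by positivity)
          ((summable_geometric_of_lt_one (by positivity) hρ4).mul_left _),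
          ENNReal.ofReal_mul (by positivity)]
        congr 2
        ext1 j
        rw [← ENNReal.ofReal_mul (by positivity), mul_pow]
        congr 1
        ring
    _ = ENNReal.ofReal (l ^ 2 * a * (1 + 4 * (1 - 4 * ρ)⁻¹)) := by
        rw [tsum_mul_left, tsum_geometric_of_lt_one (by positivity) hρ4,
          ← ENNReal.ofReal_add (by positivity)
            (mul_nonneg (by positivity) (inv_nonneg.2 (by linarith)))]
        congr 1
        ring
    _ = _ := by
        have hla : l ^ 2 * a = (ρ⁻¹ / κ) ^ (2 / p) * a ^ (1 - 2 * (1 - θ) / p) * e ^ 2 := by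
          have h1 : l ^ 2 = (ρ⁻¹ * e ^ p * a ^ (θ - 1) / κ) ^ (2 / p) := by
            rw [hl, ← Real.rpow_natCast, ← Real.rpow_mul (by positivity)]
            congr 1
            push_cast
            ring
          have h2 : a ^ (1 - 2 * (1 - θ) / p) = a * (a ^ (θ - 1)) ^ (2 / p) := by
            rw [← Real.rpow_mul ha.le, mul_comm a, ← Real.rpow_add_one ha.ne']
            congr 1
            ring
          have h3 : e ^ 2 = (e ^ p) ^ (2 / p) := by
            rw [← Real.rpow_mul he.le, mul_div_cancel₀ _ hp.ne']
            norm_cast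
          rw [h1, h2, h3, show ρ⁻¹ * e ^ p * a ^ (θ - 1) / κ = ρ⁻¹ / κ * e ^ p * a ^ (θ - 1) by ring,
            Real.mul_rpow (by positivity) (by positivity),
            Real.mul_rpow (by positivity) (by positivity)]
          ring
        rw [hla]
        congr 1
        ring

/-! ### Strong monotonicity of `J_p` and the energy -/

theorem Jp_of_nonneg {p t : ℝ} (hp : 1 < p) (ht : 0 ≤ t) : Jp p t = t ^ (p - 1) := by
  rcases eq_or_lt_of_le ht with rfl | h0
  · rw [Jp, mul_zero, Real.zero_rpow (by linarith)]
  · rw [Jp, abs_of_pos h0, ← Real.rpow_add_one h0.ne']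
    congr 1
    ring

theorem Jp_neg (p t : ℝ) : Jp p (-t) = -Jp p t := by
  simp [Jp]

theorem abs_Jp {p : ℝ} (hp : 1 < p) (t : ℝ) : |Jp p t| = |t| ^ (p - 1) := by
  rw [← Jp_of_nonneg hp (abs_nonneg t), Jp, Jp, abs_mul, abs_abs,
    abs_of_nonneg (Real.rpow_nonneg (abs_nonneg t) _)]

theorem measurable_Jp (p : ℝ) : Measurable (Jp p) := by
  unfold Jp
  fun_prop

/-- Strong monotonicity of `J_p` in the singular range `p < 2`. -/
theorem le_Jp_sub_Jp {p a b : ℝ} (hp : 1 < p) (hp₂ : p < 2) (hab : b ≤ a) :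
    (p - 1) * (|a| + |b|) ^ (p - 2) * (a - b) ≤ Jp p a - Jp p b := by
  have key : ∀ a b : ℝ, 0 ≤ b → b ≤ a →
      (p - 1) * (|a| + |b|) ^ (p - 2) * (a - b) ≤ Jp p a - Jp p b := by
    intro a b hb hab
    rcases eq_or_lt_of_le (hb.trans hab) with h0 | h0
    · have : b = 0 := le_antisymm (h0 ▸ hab) hb
      simp [← h0, this]
    · -- the graph of the concave function `t ^ (p - 1)` lies below its tangent at `a`
      have h1 : (b / a) ^ (p - 1) ≤ 1 + (p - 1) * (b / a - 1) := by
        have := rpow_one_add_le_one_add_mul_self (s := b / a - 1) (p := p - 1)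
          (by have : 0 ≤ b / a := by positivity
              linarith) (by linarith) (by linarith)
        simpa using this
      have h2 : (a + b) ^ (p - 2) ≤ a ^ (p - 2) :=
        Real.rpow_le_rpow_of_nonpos h0 (by linarith) (by linarith)
      have h3 : a ^ (p - 1) = a ^ (p - 2) * a := by
        rw [← Real.rpow_add_one h0.ne']
        congr 1
        ring
      rw [Jp_of_nonneg hp h0.le, Jp_of_nonneg hp hb, abs_of_pos h0, abs_of_nonneg hb]
      rw [Real.div_rpow hb h0.le, div_le_iff₀ (by positivity)] at h1
      calc (p - 1) * (a + b) ^ (p - 2) * (a - b) ≤ (p - 1) * a ^ (p - 2) * (a - b) := by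
            have : 0 ≤ p - 1 := by linarith
            have : 0 ≤ a - b := by linarith
            gcongr
        _ = a ^ (p - 1) - (1 + (p - 1) * (b / a - 1)) * a ^ (p - 1) := by
            rw [h3]
            field_simp
            ring
        _ ≤ _ := by linarith
  rcases le_total 0 b with hb | hb
  · exact key a b hb hab
  rcases le_total a 0 with ha | ha
  · have := key (-b) (-a) (by linarith) (by linarith)
    rw [Jp_neg, Jp_neg, abs_neg, abs_neg, add_comm |b|] at this
    linarith
  · have h1 := Real.rpow_add_le_add_rpow ha (neg_nonneg.2 hb) (by linarith : 0 ≤ p - 1)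
      (by linarith)
    rw [← Jp_of_nonneg hp ha, ← Jp_of_nonneg hp (neg_nonneg.2 hb), Jp_neg] at h1
    rw [abs_of_nonneg ha, abs_of_nonpos hb]
    rcases eq_or_lt_of_le (by linarith : 0 ≤ a + -b) with h0 | h0
    · have ha0 : a = 0 := by linarith
      have hb0 : b = 0 := by linarith
      simp [ha0, hb0, Jp]
    have h2 : (a + -b) ^ (p - 1) = (a + -b) ^ (p - 2) * (a - b) := by
      rw [← sub_eq_add_neg] at h0 ⊢
      rw [← Real.rpow_add_one h0.ne']
      congr 1
      ring
    have h3 : 0 ≤ (a + -b) ^ (p - 2) * (a - b) := by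
      rw [← h2]
      positivity
    nlinarith

/-- If `d` is a contraction of the increment `a - b`, such as the increment of a truncation, then
`J_p(a) - J_p(b)` tested against `d` controls a weighted square of `d`. -/
theorem le_Jp_sub_Jp_mul {p a b d : ℝ} (hp : 1 < p) (hp₂ : p < 2) (h₁ : |d| ≤ |a - b|)
    (h₂ : 0 ≤ d * (a - b)) :
    (p - 1) * ((|a| + |b|) ^ (p - 2) * d ^ 2) ≤ (Jp p a - Jp p b) * d := by
  have key : ∀ a b d : ℝ, b ≤ a → |d| ≤ |a - b| → 0 ≤ d * (a - b) →
      (p - 1) * ((|a| + |b|) ^ (p - 2) * d ^ 2) ≤ (Jp p a - Jp p b) * d := by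
    intro a b d hab h₁ h₂
    have h0 : 0 ≤ a - b := by linarith
    rw [abs_of_nonneg h0] at h₁
    have hd : 0 ≤ d := by
      rcases eq_or_lt_of_le h0 with h | h
      · rw [← h] at h₁
        exact (abs_nonpos_iff.1 h₁).ge
      · exact nonneg_of_mul_nonneg_left h₂ h
    rw [abs_of_nonneg hd] at h₁
    have h3 := mul_le_mul_of_nonneg_right (le_Jp_sub_Jp hp hp₂ hab) hd
    refine le_trans ?_ h3
    have h4 : 0 ≤ (p - 1) * (|a| + |b|) ^ (p - 2) := by
      have : 0 ≤ p - 1 := by linarith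
      positivity
    calc (p - 1) * ((|a| + |b|) ^ (p - 2) * d ^ 2)
        = (p - 1) * (|a| + |b|) ^ (p - 2) * (d * d) := by ring
      _ ≤ (p - 1) * (|a| + |b|) ^ (p - 2) * ((a - b) * d) := by gcongr
      _ = _ := by ring
  rcases le_total b a with h | h
  · exact key a b d h h₁ h₂
  · have := key b a (-d) h (by rwa [abs_neg, abs_sub_comm]) (by linarith)
    rw [add_comm |b|, neg_sq] at this
    linarith

section Energy

variable {α : Type*} [MeasurableSpace α] {μ : Measure α} {p : ℝ}

theorem eLpNorm_Jp (hp : 1 < p) (a : α → ℝ) :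
    eLpNorm (fun z => Jp p (a z)) (ENNReal.ofReal (p / (p - 1))) μ =
      eLpNorm a (ENNReal.ofReal p) μ ^ (p - 1) := by
  have h1 : 0 < p - 1 := by linarith
  have : ENNReal.ofReal p = ENNReal.ofReal (p / (p - 1)) * ENNReal.ofReal (p - 1) := by
    rw [← ENNReal.ofReal_mul (by positivity), div_mul_cancel₀ _ h1.ne']
  rw [this, ← eLpNorm_norm_rpow a h1]
  refine eLpNorm_congr_norm_ae (Eventually.of_forall fun z => ?_)
  simp only [Real.norm_eq_abs]
  rw [abs_Jp hp, abs_of_nonneg (a := |a z| ^ (p - 1)) (by positivity)]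

theorem memLp_Jp (hp : 1 < p) {a : α → ℝ} (ha : MemLp a (ENNReal.ofReal p) μ) :
    MemLp (fun z => Jp p (a z)) (ENNReal.ofReal (p / (p - 1))) μ := by
  refine ⟨((measurable_Jp p).comp_aemeasurable ha.1.aemeasurable).aestronglyMeasurable, ?_⟩
  rw [eLpNorm_Jp hp]
  exact ENNReal.rpow_lt_top_of_nonneg (by linarith) ha.2.ne

theorem holderTriple_conj (hp : 1 < p) :
    ENNReal.HolderTriple (ENNReal.ofReal (p / (p - 1))) (ENNReal.ofReal p) 1 := by
  have h := (Real.HolderConjugate.conjExponent hp).symm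
  exact h.ennrealOfReal

theorem integrable_Jp_mul (hp : 1 < p) {a d : α → ℝ} (ha : MemLp a (ENNReal.ofReal p) μ)
    (hd : MemLp d (ENNReal.ofReal p) μ) : Integrable (fun z => Jp p (a z) * d z) μ := by
  have := holderTriple_conj hp
  exact (memLp_Jp hp ha).integrable_mul hd

/-- The energy controls the `L^p` norm of the tested increment, by Hölder's inequality with
exponents `2 / p` and `2 / (2 - p)`. -/
theorem eLpNorm_le_sqrt_energy (hp : 1 < p) (hp₂ : p < 2) {a b d : α → ℝ} {M : ℝ} (hM : 0 < M)
    (ha : MemLp a (ENNReal.ofReal p) μ) (hb : MemLp b (ENNReal.ofReal p) μ)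
    (hd : MemLp d (ENNReal.ofReal p) μ) (h₁ : ∀ z, |d z| ≤ |a z - b z|)
    (h₂ : ∀ z, 0 ≤ d z * (a z - b z))
    (hab : eLpNorm a (ENNReal.ofReal p) μ + eLpNorm b (ENNReal.ofReal p) μ ≤ ENNReal.ofReal M) :
    0 ≤ M ^ (2 - p) / (p - 1) * ((∫ z, Jp p (a z) * d z ∂μ) - ∫ z, Jp p (b z) * d z ∂μ) ∧
      eLpNorm d (ENNReal.ofReal p) μ ≤ ENNReal.ofReal √(M ^ (2 - p) / (p - 1) *
        ((∫ z, Jp p (a z) * d z ∂μ) - ∫ z, Jp p (b z) * d z ∂μ)) := by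
  have hp0 : 0 < p := by linarith
  have hp1 : 0 < p - 1 := by linarith
  have hp2 : 0 < 2 - p := by linarith
  rw [← integral_sub (integrable_Jp_mul hp ha hd) (integrable_Jp_mul hp hb hd)]
  set I := ∫ z, (Jp p (a z) * d z - Jp p (b z) * d z) ∂μ with hI
  have hpt : ∀ z, (|a z| + |b z|) ^ (p - 2) * d z ^ 2 ≤
      (p - 1)⁻¹ * (Jp p (a z) * d z - Jp p (b z) * d z) := fun z => by
    rw [le_inv_mul_iff₀ hp1, ← sub_mul]
    exact le_Jp_sub_Jp_mul hp hp₂ (h₁ z) (h₂ z)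
  have hnn : ∀ z, 0 ≤ (|a z| + |b z|) ^ (p - 2) * d z ^ 2 := fun z => by positivity
  have hI0 : 0 ≤ (p - 1)⁻¹ * I := by
    rw [hI, ← integral_const_mul]
    exact integral_nonneg fun z => (hnn z).trans (hpt z)
  have hMI : M ^ (2 - p) / (p - 1) * I = (p - 1)⁻¹ * I * M ^ (2 - p) := by ring
  refine ⟨by rw [hMI]; positivity, ?_⟩
  have hQ : ∫⁻ z, ENNReal.ofReal ((|a z| + |b z|) ^ (p - 2) * d z ^ 2) ∂μ ≤
      ENNReal.ofReal ((p - 1)⁻¹ * I) := by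
    rw [hI, ← integral_const_mul, ofReal_integral_eq_lintegral_ofReal]
    · exact lintegral_mono fun z => ENNReal.ofReal_le_ofReal (hpt z)
    · exact ((integrable_Jp_mul hp ha hd).sub (integrable_Jp_mul hp hb hd)).const_mul _
    · exact Eventually.of_forall fun z => (hnn z).trans (hpt z)
  have hS : ∫⁻ z, ENNReal.ofReal ((|a z| + |b z|) ^ p) ∂μ ≤ ENNReal.ofReal (M ^ p) := by
    have h3 : ∫⁻ z, ENNReal.ofReal ((|a z| + |b z|) ^ p) ∂μ =
        eLpNorm (fun z => |a z| + |b z|) (ENNReal.ofReal p) μ ^ p := by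
      rw [eLpNorm_eq_lintegral_rpow_enorm_toReal (by simpa using hp0) (by simp),
        ENNReal.toReal_ofReal hp0.le, ← ENNReal.rpow_mul, one_div_mul_cancel hp0.ne',
        ENNReal.rpow_one]
      refine lintegral_congr fun z => ?_
      rw [Real.enorm_eq_ofReal (by positivity), ENNReal.ofReal_rpow_of_nonneg (by positivity) hp0.le]
    rw [h3, ← ENNReal.ofReal_rpow_of_nonneg hM.le hp0.le]
    gcongr
    refine le_trans ?_ hab
    have h4 : eLpNorm (fun z => |a z| + |b z|) (ENNReal.ofReal p) μ ≤
        eLpNorm (fun z => |a z|) (ENNReal.ofReal p) μ +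
          eLpNorm (fun z => |b z|) (ENNReal.ofReal p) μ :=
      eLpNorm_add_le ha.norm.1 hb.norm.1 (by simpa using hp.le)
    rwa [show eLpNorm (fun z => |a z|) (ENNReal.ofReal p) μ = eLpNorm a (ENNReal.ofReal p) μ from
      eLpNorm_norm a, show eLpNorm (fun z => |b z|) (ENNReal.ofReal p) μ =
        eLpNorm b (ENNReal.ofReal p) μ from eLpNorm_norm b] at h4
  have hconj : (2 / p).HolderConjugate (2 / (2 - p)) := by
    rw [Real.holderConjugate_iff]
    refine ⟨by rw [lt_div_iff₀ hp0]; linarith, ?_⟩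
    field_simp
    ring
  have ham := ha.1.aemeasurable
  have hbm := hb.1.aemeasurable
  have hdm := hd.1.aemeasurable
  have hH := ENNReal.lintegral_mul_le_Lp_mul_Lq μ hconj
    (f := fun z => ENNReal.ofReal (((|a z| + |b z|) ^ (p - 2) * d z ^ 2) ^ (p / 2)))
    (g := fun z => ENNReal.ofReal (((|a z| + |b z|) ^ p) ^ ((2 - p) / 2)))
    (by fun_prop) (by fun_prop)
  have hf : ∀ z, ENNReal.ofReal (((|a z| + |b z|) ^ (p - 2) * d z ^ 2) ^ (p / 2)) ^ (2 / p) =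
      ENNReal.ofReal ((|a z| + |b z|) ^ (p - 2) * d z ^ 2) := fun z => by
    rw [ENNReal.ofReal_rpow_of_nonneg (by positivity) (by positivity),
      ← Real.rpow_mul (by positivity)]
    field_simp
    rw [Real.rpow_one]
  have hg : ∀ z, ENNReal.ofReal (((|a z| + |b z|) ^ p) ^ ((2 - p) / 2)) ^ (2 / (2 - p)) =
      ENNReal.ofReal ((|a z| + |b z|) ^ p) := fun z => by
    rw [ENNReal.ofReal_rpow_of_nonneg (by positivity) (by positivity),
      ← Real.rpow_mul (by positivity)]
    rw [show (2 - p) / 2 * (2 / (2 - p)) = 1 by field_simp, Real.rpow_one]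
  simp_rw [hf, hg, one_div_div] at hH
  have hfg : ∀ z, ‖d z‖ₑ ^ p ≤
      ENNReal.ofReal (((|a z| + |b z|) ^ (p - 2) * d z ^ 2) ^ (p / 2)) *
        ENNReal.ofReal (((|a z| + |b z|) ^ p) ^ ((2 - p) / 2)) := fun z => by
    rw [← ENNReal.ofReal_mul (by positivity), Real.enorm_eq_ofReal_abs,
      ENNReal.ofReal_rpow_of_nonneg (abs_nonneg _) hp0.le]
    refine ENNReal.ofReal_le_ofReal ?_
    have hle : |a z - b z| ≤ |a z| + |b z| := abs_sub _ _
    rcases eq_or_lt_of_le (add_nonneg (abs_nonneg (a z)) (abs_nonneg (b z))) with h0 | h0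
    · have : d z = 0 := abs_nonpos_iff.1 ((h₁ z).trans (hle.trans h0.ge))
      rw [this, abs_zero, Real.zero_rpow hp0.ne']
      positivity
    · rw [Real.mul_rpow (by positivity) (by positivity), ← Real.rpow_mul h0.le,
        ← Real.rpow_mul h0.le, mul_right_comm, ← Real.rpow_add h0,
        show (p - 2) * (p / 2) + p * ((2 - p) / 2) = 0 by ring, Real.rpow_zero, one_mul,
        ← sq_abs, ← Real.rpow_natCast, ← Real.rpow_mul (abs_nonneg _)]
      refine le_of_eq ?_
      congr 1
      push_cast
      ring
  have hmain : ∫⁻ z, ‖d z‖ₑ ^ p ∂μ ≤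
      ENNReal.ofReal (((p - 1)⁻¹ * I) ^ (p / 2) * (M ^ p) ^ ((2 - p) / 2)) := by
    refine (lintegral_mono hfg).trans (hH.trans ?_)
    rw [ENNReal.ofReal_mul (by positivity), ← ENNReal.ofReal_rpow_of_nonneg hI0 (by positivity),
      ← ENNReal.ofReal_rpow_of_nonneg (by positivity) (by positivity)]
    gcongr
  rw [eLpNorm_eq_lintegral_rpow_enorm_toReal (by simpa using hp0) (by simp),
        ENNReal.toReal_ofReal hp0.le]
  calc (∫⁻ z, ‖d z‖ₑ ^ p ∂μ) ^ (1 / p)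
      ≤ ENNReal.ofReal (((p - 1)⁻¹ * I) ^ (p / 2) * (M ^ p) ^ ((2 - p) / 2)) ^ (1 / p) := by gcongr
    _ = _ := by
      rw [ENNReal.ofReal_rpow_of_nonneg (by positivity) (by positivity), Real.sqrt_eq_rpow,
        Real.mul_rpow (by positivity) (by positivity), ← Real.rpow_mul hI0,
        ← Real.rpow_mul (by positivity), ← Real.rpow_mul (by positivity),
        hMI,
        Real.mul_rpow hI0 (by positivity), ← Real.rpow_mul hM.le]
      congr 3 <;> field_simp

end Energy

/-! ### Lebesgue points in time and one-sided Lipschitz functions -/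

section LebesguePoints

variable {Z : Type*} [MeasurableSpace Z] {μ : Measure Z} {p : ℝ}

theorem abs_integral_mul_le (hp : 1 < p) {f g : Z → ℝ} {K : ℝ} (hK : 0 ≤ K)
    (hf : MemLp f (ENNReal.ofReal (p / (p - 1))) μ)
    (hfK : eLpNorm f (ENNReal.ofReal (p / (p - 1))) μ ≤ ENNReal.ofReal K)
    (hg : MemLp g (ENNReal.ofReal p) μ) :
    |∫ z, f z * g z ∂μ| ≤ K * (eLpNorm g (ENNReal.ofReal p) μ).toReal := by
  have := holderTriple_conj hp
  have h1 : ‖∫ z, f z * g z ∂μ‖ₑ ≤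
      ENNReal.ofReal K * eLpNorm g (ENNReal.ofReal p) μ := by
    calc ‖∫ z, f z * g z ∂μ‖ₑ ≤ ∫⁻ z, ‖f z * g z‖ₑ ∂μ := enorm_integral_le_lintegral_enorm _
      _ = eLpNorm (f • g) 1 μ := by
        rw [eLpNorm_one_eq_lintegral_enorm]
        rfl
      _ ≤ eLpNorm f (ENNReal.ofReal (p / (p - 1))) μ * eLpNorm g (ENNReal.ofReal p) μ :=
        eLpNorm_smul_le_mul_eLpNorm hg.1 hf.1
      _ ≤ _ := by gcongr
  rw [Real.enorm_eq_ofReal_abs, ← ENNReal.ofReal_toReal hg.2.ne, ← ENNReal.ofReal_mul hK] at h1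
  rwa [ENNReal.ofReal_le_ofReal_iff (by positivity)] at h1

theorem intervalIntegrable_pairing [SFinite μ] (hp : 1 < p) {t₀ t₁ : ℝ} {F : ℝ → Z → ℝ}
    {K : ℝ} (hK : 0 ≤ K) (hle : t₀ ≤ t₁)
    (hF : AEStronglyMeasurable (Function.uncurry F) ((volume.restrict (Icc t₀ t₁)).prod μ))
    (hFK : ∀ᵐ t ∂(volume.restrict (Icc t₀ t₁)), MemLp (F t) (ENNReal.ofReal (p / (p - 1))) μ ∧
      eLpNorm (F t) (ENNReal.ofReal (p / (p - 1))) μ ≤ ENNReal.ofReal K)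
    {g : Z → ℝ} (hg : MemLp g (ENNReal.ofReal p) μ) :
    IntervalIntegrable (fun t => ∫ z, F t z * g z ∂μ) volume t₀ t₁ := by
  rw [intervalIntegrable_iff_integrableOn_Icc_of_le hle]
  have hm : AEStronglyMeasurable (fun t => ∫ z, F t z * g z ∂μ) (volume.restrict (Icc t₀ t₁)) :=
    (hF.mul hg.1.comp_snd).integral_prod_right'
  refine Integrable.of_bound hm (K * (eLpNorm g (ENNReal.ofReal p) μ).toReal) ?_
  filter_upwards [hFK] with t ht
  exact abs_integral_mul_le hp hK ht.1 ht.2 hg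

/-- Almost every time is a Lebesgue point of `t ↦ ∫ F(t) g` simultaneously for all `g ∈ L^p`:
the exceptional set is chosen for a countable dense set of `g`, and the uniform bound on
`F(t)` in the dual space extends the convergence to the closure. -/
theorem ae_forall_hasDerivAt_pairing [MeasurableSpace.CountablyGenerated Z] [SigmaFinite μ]
    (hp : 1 < p) {t₀ t₁ : ℝ} {F : ℝ → Z → ℝ} {K : ℝ} (hK : 0 ≤ K) (hle : t₀ ≤ t₁)
    (hF : AEStronglyMeasurable (Function.uncurry F) ((volume.restrict (Icc t₀ t₁)).prod μ))
    (hFK : ∀ᵐ t ∂(volume.restrict (Icc t₀ t₁)), MemLp (F t) (ENNReal.ofReal (p / (p - 1))) μ ∧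
      eLpNorm (F t) (ENNReal.ofReal (p / (p - 1))) μ ≤ ENNReal.ofReal K) :
    ∀ᵐ t, t ∈ Ioo t₀ t₁ → ∀ g : Z → ℝ, MemLp g (ENNReal.ofReal p) μ →
      HasDerivAt (fun x => ∫ τ in t₀..x, ∫ z, F τ z * g z ∂μ) (∫ z, F t z * g z ∂μ) t := by
  have : Fact (1 ≤ ENNReal.ofReal p) := ⟨by simpa using hp.le⟩
  have : Fact (ENNReal.ofReal p ≠ ∞) := ⟨by simp⟩
  obtain ⟨D, hDc, hD⟩ := TopologicalSpace.exists_countable_dense (Lp ℝ (ENNReal.ofReal p) μ)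
  have hint : ∀ g : Z → ℝ, MemLp g (ENNReal.ofReal p) μ →
      IntervalIntegrable (fun t => ∫ z, F t z * g z ∂μ) volume t₀ t₁ := fun g hg =>
    intervalIntegrable_pairing hp hK hle hF hFK hg
  have hD' : ∀ᵐ t, ∀ i ∈ D, t ∈ uIcc t₀ t₁ → ∀ c ∈ uIcc t₀ t₁,
      HasDerivAt (fun x => ∫ τ in c..x, ∫ z, F τ z * i z ∂μ) (∫ z, F t z * i z ∂μ) t :=
    (ae_ball_iff hDc).2 fun i _ => (hint i (Lp.memLp i)).ae_hasDerivAt_integral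
  have hFK' := (ae_restrict_iff' measurableSet_Icc).1 hFK
  filter_upwards [hD', hFK'] with t htD htK ht g hg
  have htI : t ∈ Icc t₀ t₁ := Ioo_subset_Icc_self ht
  have htu : t ∈ uIcc t₀ t₁ := Icc_subset_uIcc htI
  -- changing `g` by a small amount changes the pairing by a small amount, uniformly in time
  have hdiff : ∀ i : Lp ℝ (ENNReal.ofReal p) μ, ∀ τ,
      (MemLp (F τ) (ENNReal.ofReal (p / (p - 1))) μ ∧
        eLpNorm (F τ) (ENNReal.ofReal (p / (p - 1))) μ ≤ ENNReal.ofReal K) →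
      |(∫ z, F τ z * g z ∂μ) - ∫ z, F τ z * i z ∂μ| ≤ K * dist hg.toLp i := by
    intro i τ hτ
    have hi := Lp.memLp i
    have := holderTriple_conj hp
    have h1 : Integrable (fun z => F τ z * g z) μ := hτ.1.integrable_mul hg
    have h2 : Integrable (fun z => F τ z * i z) μ := hτ.1.integrable_mul hi
    rw [← integral_sub h1 h2]
    simp_rw [← mul_sub]
    refine (abs_integral_mul_le hp hK hτ.1 hτ.2 (hg.sub hi)).trans (le_of_eq ?_)
    rw [Lp.dist_def]
    congr 2
    refine eLpNorm_congr_ae ?_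
    filter_upwards [hg.coeFn_toLp] with z hz
    simp [hz]
  rw [hasDerivAt_iff_isLittleO, Asymptotics.isLittleO_iff]
  intro ε hε
  obtain ⟨i, hiD, hi⟩ := hD.exists_dist_lt hg.toLp (ε := ε / (3 * (K + 1))) (by positivity)
  have hKi : K * dist hg.toLp i ≤ ε / 3 := by
    calc K * dist hg.toLp i ≤ (K + 1) * (ε / (3 * (K + 1))) := by gcongr; linarith
      _ = ε / 3 := by field_simp
  have h1 := htD i hiD htu t₀ left_mem_uIcc
  rw [hasDerivAt_iff_isLittleO, Asymptotics.isLittleO_iff] at h1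
  filter_upwards [h1 (by positivity : 0 < ε / 3), Ioo_mem_nhds ht.1 ht.2] with x hx hxI
  have hsubi : ∀ x ∈ Icc t₀ t₁, ∀ y ∈ Icc t₀ t₁, uIcc x y ⊆ uIcc t₀ t₁ := fun x hx y hy => by
    rw [uIcc_of_le hle]
    exact uIcc_subset_Icc hx hy
  have ht₀ : t₀ ∈ Icc t₀ t₁ := left_mem_Icc.2 hle
  have hxI' := Ioo_subset_Icc_self hxI
  have hii := hint i (Lp.memLp i)
  rw [intervalIntegral.integral_interval_sub_left ((hint g hg).mono_set (hsubi _ ht₀ _ hxI'))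
    ((hint g hg).mono_set (hsubi _ ht₀ _ htI))]
  rw [intervalIntegral.integral_interval_sub_left (hii.mono_set (hsubi _ ht₀ _ hxI'))
    (hii.mono_set (hsubi _ ht₀ _ htI))] at hx
  have h2 : |(∫ τ in t..x, ∫ z, F τ z * g z ∂μ) - ∫ τ in t..x, ∫ z, F τ z * i z ∂μ| ≤
      ε / 3 * |x - t| := by
    rw [← intervalIntegral.integral_sub ((hint g hg).mono_set (hsubi _ htI _ hxI'))
      (hii.mono_set (hsubi _ htI _ hxI'))]
    refine intervalIntegral.norm_integral_le_of_norm_le_const_ae (E := ℝ) ?_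
    filter_upwards [hFK'] with τ hτ hτ'
    exact (hdiff i τ (hτ (uIcc_subset_Icc htI hxI' (uIoc_subset_uIcc hτ')))).trans hKi
  have h3 : |(x - t) * (∫ z, F t z * i z ∂μ) - (x - t) * ∫ z, F t z * g z ∂μ| ≤
      ε / 3 * |x - t| := by
    rw [← mul_sub, abs_mul, mul_comm, abs_sub_comm]
    gcongr
    exact (hdiff i t (htK htI)).trans hKi
  simp only [smul_eq_mul, Real.norm_eq_abs] at hx ⊢
  refine abs_le.2 ⟨?_, ?_⟩
  · linarith [(abs_le.1 hx).1, (abs_le.1 h2).1, (abs_le.1 h3).1]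
  · linarith [(abs_le.1 hx).2, (abs_le.1 h2).2, (abs_le.1 h3).2]

end LebesguePoints

/-- A continuous function on `[t₀, t₁]` whose increments are at most `C` times the length of the
interval satisfies the integrated form of an upper bound for its derivative: after subtraction of
`C t` it is nonincreasing, and a monotone function loses at least the integral of its
derivative. -/
theorem sub_le_integral_of_deriv_le {y φ : ℝ → ℝ} {t₀ t₁ C : ℝ} (h01 : t₀ ≤ t₁)
    (hC : ∀ a ∈ Icc t₀ t₁, ∀ b ∈ Icc t₀ t₁, a ≤ b → y b - y a ≤ C * (b - a))
    (hφ : IntervalIntegrable φ volume t₀ t₁)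
    (hd : ∀ᵐ t, t ∈ Ioo t₀ t₁ → ∀ d, HasDerivAt y d t → d ≤ φ t) :
    y t₁ - y t₀ ≤ ∫ t in t₀..t₁, φ t := by
  set f : ℝ → ℝ := fun t => C * t - y t with hf
  have hmono : MonotoneOn f (uIcc t₀ t₁) := by
    rw [uIcc_of_le h01]
    intro a ha b hb hab
    have := hC a ha b hb hab
    simp only [hf]
    linarith
  have hmem := hmono.intervalIntegral_deriv_mem_uIcc
  have hle : ∫ t in t₀..t₁, deriv f t ≤ f t₁ - f t₀ := by
    have h0 : 0 ≤ f t₁ - f t₀ := sub_nonneg.2 (hmono left_mem_uIcc right_mem_uIcc h01)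
    rw [uIcc_of_le h0] at hmem
    exact hmem.2
  have hdiff : ∀ᵐ t, t ∈ Ioo t₀ t₁ → DifferentiableAt ℝ f t := by
    have h1 := (hmono.mono (Ioo_subset_Icc_self.trans (Icc_subset_uIcc))).ae_differentiableWithinAt
      measurableSet_Ioo
    rw [ae_restrict_iff' measurableSet_Ioo] at h1
    filter_upwards [h1] with t ht hti
    exact (ht hti).differentiableAt (Ioo_mem_nhds hti.1 hti.2)
  have hcmp : ∫ t in t₀..t₁, (C - φ t) ≤ ∫ t in t₀..t₁, deriv f t := by
    refine intervalIntegral.integral_mono_ae_restrict h01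
      (intervalIntegrable_const.sub hφ) hmono.intervalIntegrable_deriv ?_
    rw [← restrict_Ioo_eq_restrict_Icc, EventuallyLE, ae_restrict_iff' measurableSet_Ioo]
    filter_upwards [hdiff, hd] with t h1 h2 ht
    have h3 : HasDerivAt y (C - deriv f t) t := by
      have h4 := (((hasDerivAt_id t).const_mul C).sub (h1 ht).hasDerivAt).congr_of_eventuallyEq
        (f₁ := y) (Eventually.of_forall fun x => by simp [hf])
      rwa [mul_one] at h4
    linarith [h2 ht _ h3]
  rw [intervalIntegral.integral_sub intervalIntegrable_const hφ,
    intervalIntegral.integral_const, smul_eq_mul] at hcmp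
  simp only [hf] at hle
  linarith

/-! ### Fractional Sobolev functions and time-independent test functions -/

section SpaceFacts

variable {n : ℕ} {s p : ℝ}

instance sigmaFinite_dmu (n : ℕ) (s p : ℝ) : SigmaFinite (dmu n s p) :=
  SigmaFinite.withDensity_ofReal _

theorem dmu_absolutelyContinuous (n : ℕ) (s p : ℝ) :
    dmu n s p ≪ (volume : Measure (E n)).prod volume :=
  withDensity_absolutelyContinuous _ _

theorem quasiMeasurePreserving_fst_dmu (n : ℕ) (s p : ℝ) :
    Measure.QuasiMeasurePreserving Prod.fst (dmu n s p) (volume : Measure (E n)) :=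
  Measure.quasiMeasurePreserving_fst.mono_left (dmu_absolutelyContinuous n s p)

theorem quasiMeasurePreserving_snd_dmu (n : ℕ) (s p : ℝ) :
    Measure.QuasiMeasurePreserving Prod.snd (dmu n s p) (volume : Measure (E n)) :=
  Measure.quasiMeasurePreserving_snd.mono_left (dmu_absolutelyContinuous n s p)

theorem gagliardo_univ (u : E n → ℝ) : gagliardo s p univ u =
    eLpNorm (fun z : E n × E n => u z.1 - u z.2) (ENNReal.ofReal p) (dmu n s p) := by
  rw [gagliardo, univ_prod_univ, Measure.restrict_univ]

theorem memW_univ_iff {u : E n → ℝ} : MemW s p univ u ↔ MemLp u (ENNReal.ofReal p) volume ∧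
    MemLp (fun z : E n × E n => u z.1 - u z.2) (ENNReal.ofReal p) (dmu n s p) := by
  rw [MemW, univ_prod_univ, Measure.restrict_univ, Measure.restrict_univ]

theorem MemW.mono {A B : Set (E n)} (h : A ⊆ B) {u : E n → ℝ} (hu : MemW s p B u) :
    MemW s p A u :=
  ⟨hu.1.mono_measure (Measure.restrict_mono h le_rfl),
    hu.2.mono_measure (Measure.restrict_mono (prod_mono h h) le_rfl)⟩

theorem MemW.sobolevNorm_lt_top (hp : 0 < p) {A : Set (E n)} {u : E n → ℝ} (hu : MemW s p A u) :
    sobolevNorm s p A u < ∞ :=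
  ENNReal.rpow_lt_top_of_nonneg (by positivity) (ENNReal.add_lt_top.2
    ⟨ENNReal.rpow_lt_top_of_nonneg hp.le hu.2.2.ne,
      ENNReal.rpow_lt_top_of_nonneg hp.le hu.1.2.ne⟩).ne

theorem gagliardo_le_sobolevNorm (hp : 0 < p) (A : Set (E n)) (u : E n → ℝ) :
    gagliardo s p A u ≤ sobolevNorm s p A u := by
  rw [sobolevNorm, one_div, ENNReal.le_rpow_inv_iff hp]
  exact le_self_add

theorem eLpNorm_le_sobolevNorm (hp : 0 < p) (A : Set (E n)) (u : E n → ℝ) :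
    eLpNorm u (ENNReal.ofReal p) (volume.restrict A) ≤ sobolevNorm s p A u := by
  rw [sobolevNorm, one_div, ENNReal.le_rpow_inv_iff hp]
  exact le_add_self

theorem MemW0.ae_eq_zero (hp : 0 < p) {Ω : Set (E n)} (hΩ : MeasurableSet Ω)
    {u : E n → ℝ} (hu : MemW0 s p Ω u) : u =ᵐ[volume.restrict Ωᶜ] 0 := by
  have hm : AEStronglyMeasurable u (volume.restrict Ωᶜ) := by
    have := hu.1.1.1
    rw [Measure.restrict_univ] at this
    exact this.restrict
  have h0 : ENNReal.ofReal p ≠ 0 := by simpa using hp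
  rw [← eLpNorm_eq_zero_iff hm h0]
  refine le_antisymm (le_of_forall_pos_le_add fun ε hε => ?_) zero_le
  obtain ⟨φ, -, -, hφ, hlt⟩ := hu.2 ε hε
  rw [zero_add]
  calc eLpNorm u (ENNReal.ofReal p) (volume.restrict Ωᶜ)
      = eLpNorm (fun x => u x - φ x) (ENNReal.ofReal p) (volume.restrict Ωᶜ) := by
        refine eLpNorm_congr_ae ?_
        filter_upwards [ae_restrict_mem hΩ.compl] with x hx
        rw [image_eq_zero_of_notMem_tsupport fun h => hx (hφ h), sub_zero]
    _ ≤ eLpNorm (fun x => u x - φ x) (ENNReal.ofReal p) (volume.restrict univ) :=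
        eLpNorm_mono_measure _ (Measure.restrict_mono (subset_univ _) le_rfl)
    _ ≤ sobolevNorm s p univ (fun x => u x - φ x) := eLpNorm_le_sobolevNorm hp _ _
    _ ≤ ε := hlt.le

theorem tailMeasure_le (n : ℕ) (α : ℝ) : tailMeasure n α ≤ volume := by
  have h : tailMeasure n α ≤ (volume : Measure (E n)).withDensity 1 := by
    refine withDensity_mono (Eventually.of_forall fun x => ?_)
    have : 0 ≤ ‖x‖ ^ ((n : ℝ) + α) := by positivity
    rw [Pi.one_apply, ENNReal.ofReal_le_one, div_le_one (by positivity)]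
    linarith
  rwa [withDensity_one] at h

/-- Functions of `W^{s,p}(ℝⁿ)` that vanish outside the bounded set `Ω` belong to
`X_0^{s,p}(Ω, Ω')`. -/
theorem mem_X0 {Ω : Set (E n)} (Ω' : Set (E n)) (hΩ : MeasurableSet Ω)
    (hb : Bornology.IsBounded Ω) {g : E n → ℝ} (hg : MemW s p univ g)
    (h0 : g =ᵐ[volume.restrict Ωᶜ] 0) : g ∈ X0 s p Ω Ω' := by
  refine ⟨hg.mono (subset_univ _), ?_, h0⟩
  have hg' := (memW_univ_iff.1 hg).1
  have : IsFiniteMeasure (volume.restrict Ω) := ⟨by simpa using hb.measure_lt_top⟩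
  have h1 : MemLp g (ENNReal.ofReal (p - 1)) (volume.restrict Ω) :=
    hg'.restrict Ω |>.mono_exponent (ENNReal.ofReal_le_ofReal (by linarith))
  rw [← memLp_indicator_iff_restrict hΩ] at h1
  have h2 : Ω.indicator g =ᵐ[volume] g := by
    have := (ae_restrict_iff' hΩ.compl).1 h0
    filter_upwards [this] with x hx
    by_cases hxΩ : x ∈ Ω
    · rw [indicator_of_mem hxΩ]
    · rw [indicator_of_notMem hxΩ, hx hxΩ, Pi.zero_apply]
  exact ((memLp_congr_ae h2).1 h1).mono_measure (tailMeasure_le n _)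

/-- A function that does not depend on time is an admissible test function. -/
theorem isTest_const (hp : 0 < p) {Ω : Set (E n)} (Ω' : Set (E n)) (hΩ : MeasurableSet Ω)
    (hb : Bornology.IsBounded Ω) {g : E n → ℝ} (hg : MemW s p univ g)
    (h0 : g =ᵐ[volume.restrict Ωᶜ] 0) (h2 : MemLp g 2 (volume.restrict Ω)) (a b : ℝ) :
    IsTest s p Ω Ω' (Icc a b) (fun _ => g) (fun _ _ => 0) where
  meas := (memW_univ_iff.1 hg).1.1.comp_snd
  memLp := by
    refine ⟨Eventually.of_forall fun _ => mem_X0 Ω' hΩ hb hg h0, aemeasurable_const, ?_⟩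
    have hlt := (hg.mono (subset_univ Ω')).sobolevNorm_lt_top hp
    exact (memLp_const_enorm (c := sobolevNorm s p Ω' g) (p := ENNReal.ofReal p)
      (μ := volume.restrict (Icc a b)) hlt.ne).2
  memC1 := by
    refine ⟨fun _ => h2.toLp, fun _ => 0, continuousOn_const,
      fun t _ => hasDerivWithinAt_const _ _ _, fun t _ => ⟨h2.coeFn_toLp.symm, ?_⟩⟩
    exact (Lp.coeFn_zero _ _ _).symm

end SpaceFacts

/-- The weak form of the fractional `p`-Laplacian of `u`, tested with `g`. -/
noncomputable def energyForm {n : ℕ} (s p : ℝ) (u g : E n → ℝ) : ℝ :=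
  ∫ z : E n × E n, Jp p (u z.1 - u z.2) * (g z.1 - g z.2) ∂(dmu n s p)

/-- What the proof uses of a pair of solutions `u`, `v` on the time interval `[t₀, t₁]`: both have
Gagliardo seminorm at most `M`, their difference vanishes outside `Ω` and is continuous in time
with values in `L²(Ω)`, and the difference of the two equations holds when tested with functions
that do not depend on time. -/
structure EvolutionPair {n : ℕ} (s p : ℝ) (Ω : Set (E n)) (t₀ t₁ M : ℝ)
    (u v : ℝ → E n → ℝ) : Prop where
  meas_left : AEStronglyMeasurable
    (Function.uncurry fun t (z : E n × E n) => Jp p (u t z.1 - u t z.2))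
    ((volume.restrict (Icc t₀ t₁)).prod (dmu n s p))
  meas_right : AEStronglyMeasurable
    (Function.uncurry fun t (z : E n × E n) => Jp p (v t z.1 - v t z.2))
    ((volume.restrict (Icc t₀ t₁)).prod (dmu n s p))
  bound : ∀ᵐ t ∂(volume.restrict (Icc t₀ t₁)), MemW s p univ (u t) ∧ MemW s p univ (v t) ∧
    gagliardo s p univ (u t) + gagliardo s p univ (v t) ≤ ENNReal.ofReal M
  zero : ∀ᵐ t ∂(volume.restrict (Icc t₀ t₁)), (fun x => u t x - v t x) =ᵐ[volume.restrict Ωᶜ] 0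
  cont : ContL2 Ω (Icc t₀ t₁) fun t x => u t x - v t x
  weak : ∀ a ∈ Icc t₀ t₁, ∀ b ∈ Icc t₀ t₁, a ≤ b → ∀ g : E n → ℝ, MemW s p univ g →
    g =ᵐ[volume.restrict Ωᶜ] 0 → MemLp g 2 (volume.restrict Ω) →
    (∫ x in Ω, (u b x - v b x) * g x) - ∫ x in Ω, (u a x - v a x) * g x =
      -((∫ τ in a..b, energyForm s p (u τ) g) - ∫ τ in a..b, energyForm s p (v τ) g)

theorem EvolutionPair.symm {n : ℕ} {s p : ℝ} {Ω : Set (E n)} {t₀ t₁ M : ℝ} {u v : ℝ → E n → ℝ}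
    (h : EvolutionPair s p Ω t₀ t₁ M u v) : EvolutionPair s p Ω t₀ t₁ M v u where
  meas_left := h.meas_right
  meas_right := h.meas_left
  bound := by
    filter_upwards [h.bound] with t ht
    exact ⟨ht.2.1, ht.1, by rw [add_comm]; exact ht.2.2⟩
  zero := by
    filter_upwards [h.zero] with t ht
    filter_upwards [ht] with x hx
    simp only [Pi.zero_apply] at hx ⊢
    linarith
  cont := by
    obtain ⟨U, hU, hU'⟩ := h.cont
    refine ⟨fun t => -U t, hU.neg, fun t ht => ?_⟩
    filter_upwards [hU' t ht, Lp.coeFn_neg (U t)] with x hx hx'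
    rw [hx', Pi.neg_apply, ← hx]
    ring
  weak := by
    intro a ha b hb hab g hg h0 h2
    have h1 := h.weak a ha b hb hab g hg h0 h2
    have h3 : ∀ t, ∫ x in Ω, (v t x - u t x) * g x = -∫ x in Ω, (u t x - v t x) * g x := fun t => by
      rw [← integral_neg]
      congr 1 with x
      ring
    rw [h3, h3]
    linarith

theorem ContL2.memLp {n : ℕ} {Ω : Set (E n)} {J : Set ℝ} {u : ℝ → E n → ℝ} (h : ContL2 Ω J u)
    {t : ℝ} (ht : t ∈ J) : MemLp (u t) 2 (volume.restrict Ω) := by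
  obtain ⟨U, -, hU⟩ := h
  exact (memLp_congr_ae (hU t ht)).2 (Lp.memLp (U t))

theorem aestronglyMeasurable_Jp_sub {n : ℕ} {s p : ℝ} {u : ℝ → E n → ℝ} {I J : Set ℝ}
    (hJ : J ⊆ I)
    (hu : AEStronglyMeasurable (Function.uncurry u) ((volume.restrict I).prod volume)) :
    AEStronglyMeasurable (Function.uncurry fun t (z : E n × E n) => Jp p (u t z.1 - u t z.2))
      ((volume.restrict J).prod (dmu n s p)) := by
  have hid : Measure.QuasiMeasurePreserving id (volume.restrict J) (volume.restrict I) :=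
    (Measure.QuasiMeasurePreserving.id _).mono_left
      (Measure.restrict_mono hJ le_rfl).absolutelyContinuous
  have h1 := hu.comp_quasiMeasurePreserving 
    (QuasiMeasurePreserving.prodMap hid (quasiMeasurePreserving_fst_dmu n s p))
  have h2 := hu.comp_quasiMeasurePreserving 
    (QuasiMeasurePreserving.prodMap hid (quasiMeasurePreserving_snd_dmu n s p))
  exact ((measurable_Jp p).comp_aemeasurable (h1.sub h2).aemeasurable).aestronglyMeasurable

theorem evolutionPair_of_isWeakSolution {n : ℕ} {s p : ℝ} (hp : 1 < p)
    {Ω Ω' : Set (E n)} (hΩ : MeasurableSet Ω) (hb : Bornology.IsBounded Ω)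
    {f : ℝ → X0Functional s p Ω Ω'} {u v : ℝ → E n → ℝ}
    (hu : IsWeakSolution s p Ω Ω' (Ioi 0) f u) (hv : IsWeakSolution s p Ω Ω' (Ioi 0) f v)
    (hw : MemLpTimeLoc (MemW0 s p Ω) (sobolevNorm s p univ) (ENNReal.ofReal p) (Ioi 0)
      (fun t x => u t x - v t x))
    {t₀ t₁ M : ℝ} (ht₀ : 0 < t₀) (h01 : t₀ < t₁)
    (hbd : ∀ᵐ t ∂(volume.restrict (Icc t₀ t₁)), MemW s p univ (u t) ∧ MemW s p univ (v t) ∧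
      gagliardo s p univ (u t) + gagliardo s p univ (v t) ≤ ENNReal.ofReal M) :
    EvolutionPair s p Ω t₀ t₁ M u v := by
  have hsub : Icc t₀ t₁ ⊆ Ioi 0 := fun x hx => ht₀.trans_le hx.1
  have hp0 : 0 < p := by linarith
  refine ⟨aestronglyMeasurable_Jp_sub hsub hu.meas, aestronglyMeasurable_Jp_sub hsub hv.meas,
    hbd, ?_, ?_, ?_⟩
  · filter_upwards [(hw t₀ t₁ h01 hsub).1] with t ht
    exact ht.ae_eq_zero hp0 hΩ
  · obtain ⟨U, hU, hU'⟩ := hu.cont t₀ t₁ h01 hsub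
    obtain ⟨V, hV, hV'⟩ := hv.cont t₀ t₁ h01 hsub
    refine ⟨fun t => U t - V t, hU.sub hV, fun t ht => ?_⟩
    filter_upwards [hU' t ht, hV' t ht, Lp.coeFn_sub (U t) (V t)] with x h1 h2 h3
    rw [h3, Pi.sub_apply, h1, h2]
  · intro a ha b hb' hab g hg h0 h2
    rcases eq_or_lt_of_le hab with rfl | hlt
    · simp
    have hsub' : Icc a b ⊆ Ioi 0 := (Icc_subset_Icc ha.1 hb'.2).trans hsub
    have htest := isTest_const hp0 Ω' hΩ hb hg h0 h2 a b
    have e1 := hu.weak a b hlt hsub' _ _ htest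
    have e2 := hv.weak a b hlt hsub' _ _ htest
    have hint : ∀ t ∈ Icc t₀ t₁, ∫ x in Ω, (u t x - v t x) * g x =
        (∫ x in Ω, u t x * g x) - ∫ x in Ω, v t x * g x := fun t ht => by
      have i1 : Integrable (fun x => u t x * g x) (volume.restrict Ω) :=
        ((hu.cont t₀ t₁ h01 hsub).memLp ht).integrable_mul h2
      have i2 : Integrable (fun x => v t x * g x) (volume.restrict Ω) :=
        ((hv.cont t₀ t₁ h01 hsub).memLp ht).integrable_mul h2
      simp_rw [sub_mul]
      exact integral_sub i1 i2
    rw [hint b hb', hint a ha, intervalIntegral.integral_of_le hab,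
      intervalIntegral.integral_of_le hab, ← integral_Icc_eq_integral_Ioc,
      ← integral_Icc_eq_integral_Ioc]
    simp only [mul_zero, integral_zero, neg_zero, zero_add] at e1 e2
    unfold energyForm
    rw [e1, e2]
    ring

/-! ### Truncations and the energy inequality -/

/-- The part `(w - k)_+` of `w` above the level `k`. -/
def trunc {α : Type*} (k : ℝ) (w : α → ℝ) : α → ℝ := fun x => max (w x - k) 0

section Trunc

variable {α : Type*} {k : ℝ} (w : α → ℝ)

theorem trunc_nonneg (x : α) : 0 ≤ trunc k w x := le_max_right _ _

theorem abs_trunc_sub_le (x y : α) : |trunc k w x - trunc k w y| ≤ |w x - w y| := by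
  have := abs_max_sub_max_le_abs (w x - k) (w y - k) 0
  rwa [sub_sub_sub_cancel_right] at this

theorem trunc_sub_mul_nonneg (x y : α) :
    0 ≤ (trunc k w x - trunc k w y) * (w x - w y) := by
  rcases le_total (w x) (w y) with h | h
  · have : trunc k w x ≤ trunc k w y := max_le_max_right _ (by linarith)
    exact mul_nonneg_of_nonpos_of_nonpos (by linarith) (by linarith)
  · have : trunc k w y ≤ trunc k w x := max_le_max_right _ (by linarith)
    exact mul_nonneg (by linarith) (by linarith)

theorem abs_trunc_le (hk : 0 ≤ k) (x : α) : |trunc k w x| ≤ |w x| := by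
  rw [abs_of_nonneg (trunc_nonneg w x)]
  exact max_le (by linarith [le_abs_self (w x)]) (abs_nonneg _)

/-- Convexity of the square of the positive part. -/
theorem sq_max_sub_sq_max_le (a b k : ℝ) :
    max (b - k) 0 ^ 2 - max (a - k) 0 ^ 2 ≤ 2 * ((b - a) * max (b - k) 0) := by
  rcases le_total (b - k) 0 with hb | hb <;> rcases le_total (a - k) 0 with ha | ha <;>
    simp only [max_eq_left, max_eq_right, ha, hb] <;> nlinarith [sq_nonneg (a - b)]

theorem aestronglyMeasurable_trunc [MeasurableSpace α] {μ : Measure α} {w : α → ℝ}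
    (hw : AEStronglyMeasurable w μ) : AEStronglyMeasurable (trunc k w) μ :=
  ((hw.aemeasurable.sub_const k).max aemeasurable_const).aestronglyMeasurable

theorem memLp_trunc [MeasurableSpace α] {μ : Measure α} {q : ℝ≥0∞} {w : α → ℝ} (hk : 0 ≤ k)
    (hw : MemLp w q μ) : MemLp (trunc k w) q μ :=
  hw.mono (aestronglyMeasurable_trunc hw.1) (Eventually.of_forall (abs_trunc_le w hk))

end Trunc

section TruncSobolev

variable {n : ℕ} {s p k : ℝ} {w w' : E n → ℝ}

theorem memW_trunc (hk : 0 ≤ k) (hw : MemW s p univ w) : MemW s p univ (trunc k w) := by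
  rw [memW_univ_iff] at hw ⊢
  refine ⟨memLp_trunc hk hw.1, hw.2.mono ?_ (Eventually.of_forall fun z => abs_trunc_sub_le w _ _)⟩
  have hm : AEStronglyMeasurable (trunc k w) volume := aestronglyMeasurable_trunc hw.1.1
  exact (hm.comp_quasiMeasurePreserving (quasiMeasurePreserving_fst_dmu n s p)).sub
    (hm.comp_quasiMeasurePreserving (quasiMeasurePreserving_snd_dmu n s p))

theorem gagliardo_congr_ae (h : w =ᵐ[volume] w') :
    gagliardo s p univ w = gagliardo s p univ w' := by
  rw [gagliardo_univ, gagliardo_univ]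
  refine eLpNorm_congr_ae ?_
  filter_upwards [(quasiMeasurePreserving_fst_dmu n s p).ae h,
    (quasiMeasurePreserving_snd_dmu n s p).ae h] with z h1 h2
  rw [h1, h2]

theorem MemW.sub {u v : E n → ℝ} {A : Set (E n)} (hu : MemW s p A u) (hv : MemW s p A v) :
    MemW s p A (fun x => u x - v x) := by
  refine ⟨hu.1.sub hv.1, ?_⟩
  convert hu.2.sub hv.2 using 1
  ext z
  simp only [Pi.sub_apply]
  ring

theorem gagliardo_sub_le (hp : 1 ≤ p) {u v : E n → ℝ} (hu : MemW s p univ u)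
    (hv : MemW s p univ v) : gagliardo s p univ (fun x => u x - v x) ≤
      gagliardo s p univ u + gagliardo s p univ v := by
  have := eLpNorm_sub_le (memW_univ_iff.1 hu).2.1 (memW_univ_iff.1 hv).2.1
    (by simpa using hp : 1 ≤ ENNReal.ofReal p)
  rw [gagliardo_univ, gagliardo_univ, gagliardo_univ]
  convert this using 2
  ext z
  simp only [Pi.sub_apply]
  ring

theorem gagliardo_trunc_le : gagliardo s p univ (trunc k w) ≤ gagliardo s p univ w := by
  rw [gagliardo_univ, gagliardo_univ]
  exact eLpNorm_mono fun z => abs_trunc_sub_le w _ _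

end TruncSobolev

/-- The squared `L²(Ω)` norm of the part of `w(t)` above the level `k`. -/
noncomputable def excess {n : ℕ} (Ω : Set (E n)) (w : ℝ → E n → ℝ) (k t : ℝ) : ℝ :=
  ∫ x in Ω, trunc k (w t) x ^ 2

theorem excess_nonneg {n : ℕ} (Ω : Set (E n)) (w : ℝ → E n → ℝ) (k t : ℝ) :
    0 ≤ excess Ω w k t :=
  integral_nonneg fun _ => sq_nonneg _

theorem ContL2.continuousOn_excess {n : ℕ} {Ω : Set (E n)} {J : Set ℝ} {w : ℝ → E n → ℝ}
    (h : ContL2 Ω J w) {k : ℝ} (hk : 0 ≤ k) : ContinuousOn (excess Ω w k) J := by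
  obtain ⟨U, hU, hU'⟩ := h
  have hl : LipschitzWith 1 (fun x : ℝ => max (x - k) 0) :=
    LipschitzWith.of_dist_le_mul fun a b => by
      rw [NNReal.coe_one, one_mul]
      exact abs_trunc_sub_le (fun x : ℝ => x) a b
  have h0 : (fun x : ℝ => max (x - k) 0) 0 = 0 := by simpa using hk
  have hc : ContinuousOn (fun t => hl.compLp h0 (U t)) J :=
    (hl.continuous_compLp h0).comp_continuousOn hU
  refine (hc.inner (𝕜 := ℝ) hc).congr fun t ht => ?_
  beta_reduce
  rw [L2.inner_def, excess]
  refine integral_congr_ae ?_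
  filter_upwards [hU' t ht, hl.coeFn_compLp h0 (U t)] with x h1 h2
  rw [h2, Function.comp_apply, real_inner_self_eq_norm_sq, Real.norm_eq_abs, sq_abs, ← h1]
  rfl

theorem ContL2.integrable_sq_trunc {n : ℕ} {Ω : Set (E n)} {J : Set ℝ} {w : ℝ → E n → ℝ}
    (h : ContL2 Ω J w) {k : ℝ} (hk : 0 ≤ k) {t : ℝ} (ht : t ∈ J) :
    Integrable (fun x => trunc k (w t) x ^ 2) (volume.restrict Ω) :=
  (memLp_trunc hk (h.memLp ht)).integrable_sq

theorem ContL2.excess_anti {n : ℕ} {Ω : Set (E n)} {J : Set ℝ} {w : ℝ → E n → ℝ}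
    (h : ContL2 Ω J w) {k k' : ℝ} (hk : 0 ≤ k) (hkk' : k ≤ k') {t : ℝ} (ht : t ∈ J) :
    excess Ω w k' t ≤ excess Ω w k t := by
  refine integral_mono (h.integrable_sq_trunc (hk.trans hkk') ht) (h.integrable_sq_trunc hk ht)
    fun x => ?_
  have : trunc k' (w t) x ≤ trunc k (w t) x := max_le_max_right _ (by linarith)
  exact pow_le_pow_left₀ (trunc_nonneg _ _) this 2

namespace EvolutionPair

variable {n : ℕ} {s p : ℝ} {Ω : Set (E n)} {t₀ t₁ M : ℝ} {u v : ℝ → E n → ℝ}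

theorem restrict (h : EvolutionPair s p Ω t₀ t₁ M u v) {a b : ℝ} (ha : a ∈ Icc t₀ t₁)
    (hb : b ∈ Icc t₀ t₁) : EvolutionPair s p Ω a b M u v := by
  have hsub : Icc a b ⊆ Icc t₀ t₁ := Icc_subset_Icc ha.1 hb.2
  have hac : (volume.restrict (Icc a b)).prod (dmu n s p) ≪
      (volume.restrict (Icc t₀ t₁)).prod (dmu n s p) :=
    (Measure.restrict_mono hsub le_rfl).absolutelyContinuous.prod .rfl
  refine ⟨h.meas_left.mono_ac hac, h.meas_right.mono_ac hac,
    ae_restrict_of_ae_restrict_of_subset hsub h.bound,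
    ae_restrict_of_ae_restrict_of_subset hsub h.zero, ?_, fun c hc d hd => h.weak c (hsub hc) d
      (hsub hd)⟩
  obtain ⟨U, hU, hU'⟩ := h.cont
  exact ⟨U, hU.mono hsub, fun t ht => hU' t (hsub ht)⟩

theorem dual_bound_left (h : EvolutionPair s p Ω t₀ t₁ M u v) (hp : 1 < p) (hM : 0 < M) :
    ∀ᵐ t ∂(volume.restrict (Icc t₀ t₁)),
      MemLp (fun z : E n × E n => Jp p (u t z.1 - u t z.2)) (ENNReal.ofReal (p / (p - 1)))
        (dmu n s p) ∧
      eLpNorm (fun z : E n × E n => Jp p (u t z.1 - u t z.2)) (ENNReal.ofReal (p / (p - 1)))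
        (dmu n s p) ≤ ENNReal.ofReal (M ^ (p - 1)) := by
  filter_upwards [h.bound] with t ht
  refine ⟨memLp_Jp hp (memW_univ_iff.1 ht.1).2, ?_⟩
  rw [eLpNorm_Jp hp (fun z : E n × E n => u t z.1 - u t z.2),
    ← ENNReal.ofReal_rpow_of_nonneg hM.le (by linarith), ← gagliardo_univ]
  exact ENNReal.rpow_le_rpow (le_self_add.trans ht.2.2) (by linarith)

theorem memLp_trunc_increment (hp : 1 ≤ p) {k : ℝ} (hk : 0 ≤ k) {t : ℝ}
    (ht : MemW s p univ (u t) ∧ MemW s p univ (v t) ∧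
      gagliardo s p univ (u t) + gagliardo s p univ (v t) ≤ ENNReal.ofReal M) :
    MemLp (fun z : E n × E n => trunc k (fun x => u t x - v t x) z.1 -
      trunc k (fun x => u t x - v t x) z.2) (ENNReal.ofReal p) (dmu n s p) ∧
    eLpNorm (fun z : E n × E n => trunc k (fun x => u t x - v t x) z.1 -
      trunc k (fun x => u t x - v t x) z.2) (ENNReal.ofReal p) (dmu n s p) ≤
        ENNReal.ofReal M := by
  refine ⟨(memW_univ_iff.1 (memW_trunc hk (ht.1.sub ht.2.1))).2, ?_⟩
  rw [← gagliardo_univ]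
  exact gagliardo_trunc_le.trans ((gagliardo_sub_le hp ht.1 ht.2.1).trans ht.2.2)

/-- By convexity, testing with the truncation at the final time bounds the increase of the
excess. -/
theorem excess_sub_le (h : EvolutionPair s p Ω t₀ t₁ M u v) {k : ℝ} (hk : 0 ≤ k) :
    ∀ᵐ b ∂(volume.restrict (Icc t₀ t₁)), ∀ a ∈ Icc t₀ t₁, a ≤ b →
      excess Ω (fun t x => u t x - v t x) k b - excess Ω (fun t x => u t x - v t x) k a ≤
        -2 * ((∫ τ in a..b, energyForm s p (u τ) (trunc k fun x => u b x - v b x)) -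
          ∫ τ in a..b, energyForm s p (v τ) (trunc k fun x => u b x - v b x)) := by
  filter_upwards [h.bound, h.zero, ae_restrict_mem measurableSet_Icc] with b hb hz hbI a ha hab
  have hg := memW_trunc hk (hb.1.sub hb.2.1)
  have hg2 := memLp_trunc hk (h.cont.memLp hbI)
  have hg0 : trunc k (fun x => u b x - v b x) =ᵐ[volume.restrict Ωᶜ] 0 := by
    filter_upwards [hz] with x hx
    simp only [trunc, Pi.zero_apply] at hx ⊢
    rw [hx, zero_sub, max_eq_right (by linarith)]
  have hw := h.weak a ha b hbI hab _ hg hg0 hg2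
  rw [neg_mul, ← mul_neg, ← hw]
  have ib : Integrable (fun x => (u b x - v b x) * trunc k (fun x => u b x - v b x) x)
      (volume.restrict Ω) := (h.cont.memLp hbI).integrable_mul hg2
  have ia : Integrable (fun x => (u a x - v a x) * trunc k (fun x => u b x - v b x) x)
      (volume.restrict Ω) := (h.cont.memLp ha).integrable_mul hg2
  rw [← integral_sub ib ia, ← integral_const_mul, excess, excess,
    ← integral_sub (h.cont.integrable_sq_trunc hk hbI) (h.cont.integrable_sq_trunc hk ha)]
  refine integral_mono ((h.cont.integrable_sq_trunc hk hbI).sub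
    (h.cont.integrable_sq_trunc hk ha)) ((ib.sub ia).const_mul 2) fun x => ?_
  simp only [← sub_mul]
  exact sq_max_sub_sq_max_le _ _ _

/-- With both seminorms at most `M`, the form is at most `M ^ (p - 1) * M` at almost every time. -/
theorem energyForm_integral_le (hp : 1 < p) (hM : 0 < M) {a b : ℝ} (hab : a ≤ b)
    {g : E n → ℝ}
    (hF : ∀ᵐ t ∂(volume.restrict (Icc a b)),
      MemLp (fun z : E n × E n => Jp p (u t z.1 - u t z.2)) (ENNReal.ofReal (p / (p - 1)))
        (dmu n s p) ∧
      eLpNorm (fun z : E n × E n => Jp p (u t z.1 - u t z.2)) (ENNReal.ofReal (p / (p - 1)))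
        (dmu n s p) ≤ ENNReal.ofReal (M ^ (p - 1)))
    (hg : MemLp (fun z : E n × E n => g z.1 - g z.2) (ENNReal.ofReal p) (dmu n s p))
    (hgM : eLpNorm (fun z : E n × E n => g z.1 - g z.2) (ENNReal.ofReal p) (dmu n s p) ≤
      ENNReal.ofReal M) :
    |∫ τ in a..b, energyForm s p (u τ) g| ≤ M ^ (p - 1) * M * (b - a) := by
  rw [← abs_of_nonneg (sub_nonneg.2 hab)]
  refine intervalIntegral.norm_integral_le_of_norm_le_const_ae (E := ℝ) ?_
  filter_upwards [(ae_restrict_iff' measurableSet_Icc).1 hF] with τ hτ hτI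
  rw [uIoc_of_le hab] at hτI
  have hτ' := hτ (Ioc_subset_Icc_self hτI)
  refine (abs_integral_mul_le hp (by positivity) hτ'.1 hτ'.2 hg).trans ?_
  gcongr
  exact ENNReal.toReal_le_of_le_ofReal hM.le hgM

/-- The increments of the excess are bounded above by a multiple of the length of the time
interval. -/
theorem excess_sub_le_mul (h : EvolutionPair s p Ω t₀ t₁ M u v) (hp : 1 < p) (hM : 0 < M)
    {k : ℝ} (hk : 0 ≤ k) {a b : ℝ} (ha : a ∈ Icc t₀ t₁) (hb : b ∈ Icc t₀ t₁) (hab : a ≤ b) :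
    excess Ω (fun t x => u t x - v t x) k b - excess Ω (fun t x => u t x - v t x) k a ≤
      4 * (M ^ (p - 1) * M) * (b - a) := by
  rcases eq_or_lt_of_le hab with rfl | hlt
  · simp
  set y := excess Ω (fun t x => u t x - v t x) k with hy
  -- the bound holds at almost every final time, hence at every one by continuity of the excess
  have hae : ∀ᵐ c ∂(volume.restrict (Icc a b)), y c - y a ≤ 4 * (M ^ (p - 1) * M) * (c - a) := by
    have hr := h.restrict ha hb
    filter_upwards [hr.excess_sub_le hk, hr.bound, ae_restrict_mem measurableSet_Icc]
      with c hc hbd hcI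
    have h1 := hc a (left_mem_Icc.2 hab) hcI.1
    obtain ⟨hg, hgM⟩ := memLp_trunc_increment hp.le hk hbd
    have hr' := hr.restrict (left_mem_Icc.2 hab) hcI
    have h2 := energyForm_integral_le hp hM hcI.1 (hr'.dual_bound_left hp hM) hg hgM
    have h3 := energyForm_integral_le hp hM hcI.1 (hr'.symm.dual_bound_left hp hM) hg hgM
    linarith [(abs_le.1 h2).1, (abs_le.1 h3).2]
  have hcont : ContinuousOn (fun c => max (y c - y a - 4 * (M ^ (p - 1) * M) * (c - a)) 0)
      (Icc a b) := by
    have : ContinuousOn y (Icc a b) :=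
      (h.cont.continuousOn_excess hk).mono (Icc_subset_Icc ha.1 hb.2)
    fun_prop
  have hzero := Measure.eqOn_Icc_of_ae_eq volume hlt.ne (g := fun _ => (0 : ℝ))
    (by filter_upwards [hae] with c hc using max_eq_right (by linarith)) hcont continuousOn_const
    (right_mem_Icc.2 hab)
  have := (max_eq_right_iff.1 hzero)
  linarith

/-- At almost every time the derivative of the excess, where it exists, is bounded by the energy
tested with the truncation at the same time. -/
theorem deriv_excess_le (h : EvolutionPair s p Ω t₀ t₁ M u v) (hp : 1 < p) (hM : 0 < M)
    (h01 : t₀ ≤ t₁) {k : ℝ} (hk : 0 ≤ k) :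
    ∀ᵐ t, t ∈ Ioo t₀ t₁ → ∀ d, HasDerivAt (excess Ω (fun t x => u t x - v t x) k) d t →
      d ≤ -2 * (energyForm s p (u t) (trunc k fun x => u t x - v t x) -
        energyForm s p (v t) (trunc k fun x => u t x - v t x)) := by
  have hK : 0 ≤ M ^ (p - 1) := by positivity
  filter_upwards [(ae_restrict_iff' measurableSet_Icc).1 (h.excess_sub_le hk),
    (ae_restrict_iff' measurableSet_Icc).1 h.bound,
    ae_forall_hasDerivAt_pairing hp hK h01 h.meas_left (h.dual_bound_left hp hM),
    ae_forall_hasDerivAt_pairing hp hK h01 h.meas_right (h.symm.dual_bound_left hp hM)]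
    with t h1 h2 hu hv ht d hd
  have htI := Ioo_subset_Icc_self ht
  obtain ⟨hg, -⟩ := memLp_trunc_increment hp.le hk (h2 htI)
  have hdu := hu ht _ hg
  have hdv := hv ht _ hg
  set g := trunc k fun x => u t x - v t x with hgdef
  -- with `g` fixed, the excess plus twice the primitive of the energy tested with `g` is, to the
  -- left of `t`, at least its value at `t`
  have hq := hd.add ((hdu.sub hdv).const_mul 2)
  rw [hasDerivAt_iff_tendsto_slope] at hq
  have hq' := hq.mono_left (nhdsWithin_mono t (show Iio t ⊆ {t}ᶜ from fun x hx => ne_of_lt hx))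
  have hle := le_of_tendsto hq' (b := 0) ?_
  · unfold energyForm
    linarith
  filter_upwards [Ioo_mem_nhdsLT ht.1] with a ha
  have haI : a ∈ Icc t₀ t₁ := ⟨ha.1.le, (ha.2.trans ht.2).le⟩
  have h3 := h1 htI a haI ha.2.le
  have hiu : ∀ c ∈ Icc t₀ t₁, IntervalIntegrable (fun τ => energyForm s p (u τ) g) volume t₀ c :=
    fun c hc => (intervalIntegrable_pairing hp hK h01 h.meas_left
      (h.dual_bound_left hp hM) hg).mono_set (by
        rw [uIcc_of_le h01]; exact uIcc_subset_Icc (left_mem_Icc.2 h01) hc)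
  have hiv : ∀ c ∈ Icc t₀ t₁, IntervalIntegrable (fun τ => energyForm s p (v τ) g) volume t₀ c :=
    fun c hc => (intervalIntegrable_pairing hp hK h01 h.meas_right
      (h.symm.dual_bound_left hp hM) hg).mono_set (by
        rw [uIcc_of_le h01]; exact uIcc_subset_Icc (left_mem_Icc.2 h01) hc)
  rw [← intervalIntegral.integral_interval_sub_left (hiu t htI) (hiu a haI),
    ← intervalIntegral.integral_interval_sub_left (hiv t htI) (hiv a haI)] at h3
  rw [slope_def_field]
  refine div_nonpos_of_nonneg_of_nonpos ?_ (by linarith [ha.2])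
  simp only [Pi.add_apply, Pi.sub_apply]
  unfold energyForm at h3
  linarith

end EvolutionPair

/-! ### Decay of the excess and De Giorgi's iteration -/

namespace EvolutionPair

variable {n : ℕ} {s p : ℝ} {Ω : Set (E n)} {t₀ t₁ M : ℝ} {u v : ℝ → E n → ℝ}

theorem energy_trunc (hp : 1 < p) (hp₂ : p < 2) (hM : 0 < M) {k : ℝ} (hk : 0 ≤ k) {t : ℝ}
    (ht : MemW s p univ (u t) ∧ MemW s p univ (v t) ∧
      gagliardo s p univ (u t) + gagliardo s p univ (v t) ≤ ENNReal.ofReal M) :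
    0 ≤ M ^ (2 - p) / (p - 1) * (energyForm s p (u t) (trunc k fun x => u t x - v t x) -
        energyForm s p (v t) (trunc k fun x => u t x - v t x)) ∧
      gagliardo s p univ (trunc k fun x => u t x - v t x) ≤
        ENNReal.ofReal √(M ^ (2 - p) / (p - 1) *
          (energyForm s p (u t) (trunc k fun x => u t x - v t x) -
            energyForm s p (v t) (trunc k fun x => u t x - v t x))) := by
  rw [gagliardo_univ (trunc k _)]
  have h3 : ∀ z : E n × E n, u t z.1 - v t z.1 - (u t z.2 - v t z.2) =
      u t z.1 - u t z.2 - (v t z.1 - v t z.2) := fun z => by ring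
  refine eLpNorm_le_sqrt_energy hp hp₂ hM (memW_univ_iff.1 ht.1).2 (memW_univ_iff.1 ht.2.1).2
    (memLp_trunc_increment hp.le hk ht).1 (fun z => ?_) (fun z => ?_) ?_
  · rw [← h3]
    exact abs_trunc_sub_le (fun x => u t x - v t x) _ _
  · rw [← h3]
    exact trunc_sub_mul_nonneg (fun x => u t x - v t x) _ _
  · have := ht.2.2
    rwa [gagliardo_univ, gagliardo_univ] at this

/-- The excess above `k'` is controlled by the energy, with a factor that is small when the excess
above a lower level `k` is: by Chebyshev's inequality the latter bounds the measure of
`{u - v > k'}`. -/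
theorem excess_le_energy (h : EvolutionPair s p Ω t₀ t₁ M u v) (hp : 1 < p) (hp₂ : p < 2)
    (hM : 0 < M) (hΩ : MeasurableSet Ω) (hfin : volume Ω ≠ ∞) {V C δ : ℝ}
    (hV : volume.real Ω ≤ V) (hC : 0 < C) (hS : SupportSobolev n s p δ C V)
    {k k' : ℝ} (hk : 0 ≤ k) (hkk' : k < k') :
    ∀ᵐ t ∂(volume.restrict (Icc t₀ t₁)), ∀ A, 0 < A →
      excess Ω (fun t x => u t x - v t x) k t / (k' - k) ^ 2 ≤ A →
      excess Ω (fun t x => u t x - v t x) k' t ≤ C * A ^ δ * (M ^ (2 - p) / (p - 1) *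
        (energyForm s p (u t) (trunc k' fun x => u t x - v t x) -
          energyForm s p (v t) (trunc k' fun x => u t x - v t x))) := by
  filter_upwards [h.bound, h.zero, ae_restrict_mem measurableSet_Icc] with t hb hz htI A hA hAle
  have hk' : 0 ≤ k' := hk.trans hkk'.le
  obtain ⟨hX, hgag⟩ := energy_trunc hp hp₂ hM hk' hb
  set X := M ^ (2 - p) / (p - 1) * (energyForm s p (u t) (trunc k' fun x => u t x - v t x) -
          energyForm s p (v t) (trunc k' fun x => u t x - v t x)) with hXdef
  set w : E n → ℝ := fun x => u t x - v t x with hw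
  have hwm : AEStronglyMeasurable w volume := (memW_univ_iff.1 (hb.1.sub hb.2.1)).1.1
  set w' := hwm.mk w with hw'
  have hww' : w =ᵐ[volume] w' := hwm.ae_eq_mk
  have hw'm : Measurable w' := hwm.stronglyMeasurable_mk.measurable
  set g := trunc k' w' with hg
  have hgm : Measurable g := (hw'm.sub_const k').max measurable_const
  have hwg : trunc k' w =ᵐ[volume] g := by
    filter_upwards [hww'] with x hx
    simp only [hg, trunc, hx]
  set S := {x | 0 < g x} with hSdef
  have hSm : MeasurableSet S := measurableSet_lt measurable_const hgm
  have hnull : volume (S \ Ω) = 0 := by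
    have h1 := (ae_restrict_iff' hΩ.compl).1 hz
    rw [measure_eq_zero_iff_ae_notMem]
    filter_upwards [h1, hww'] with x hx hx' hxS
    have h2 : w x = 0 := hx hxS.2
    have h3 : 0 < max (w' x - k') 0 := hxS.1
    rw [← hx', h2, zero_sub, max_eq_right (by linarith)] at h3
    exact lt_irrefl _ h3
  have hSvol : volume S = volume.restrict Ω S := by
    rw [Measure.restrict_apply hSm, ← measure_inter_add_sdiff S hΩ, hnull, add_zero]
  have hSfin : volume S ≠ ∞ := by
    rw [hSvol]
    exact ne_top_of_le_ne_top hfin ((measure_mono (subset_univ _)).trans (by simp))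
  have hSV : volume.real S ≤ V := by
    refine le_trans ?_ hV
    rw [measureReal_def, measureReal_def, hSvol]
    exact ENNReal.toReal_mono hfin ((measure_mono (subset_univ _)).trans (by simp))
  have hint : ∀ j, 0 ≤ j → ENNReal.ofReal (excess Ω (fun t x => u t x - v t x) j t) =
      ∫⁻ x in Ω, ENNReal.ofReal (trunc j w' x ^ 2) := fun j hj => by
    rw [excess, ofReal_integral_eq_lintegral_ofReal (h.cont.integrable_sq_trunc hj htI)
      (Eventually.of_forall fun x => sq_nonneg _)]
    refine lintegral_congr_ae ?_
    filter_upwards [ae_restrict_of_ae hww'] with x hx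
    change ENNReal.ofReal (trunc j w x ^ 2) = _
    simp only [trunc, hx]
  have hkk : 0 < (k' - k) ^ 2 := pow_pos (by linarith) 2
  have hcheb : ENNReal.ofReal ((k' - k) ^ 2) * volume S ≤
      ENNReal.ofReal (excess Ω (fun t x => u t x - v t x) k t) := by
    rw [hint k hk, hSvol, ← setLIntegral_const]
    have hSr : ∫⁻ x in S, ENNReal.ofReal ((k' - k) ^ 2) ∂(volume.restrict Ω) ≤
        ∫⁻ x in S, ENNReal.ofReal (trunc k w' x ^ 2) ∂(volume.restrict Ω) := by
      refine setLIntegral_mono' hSm fun x hx => ENNReal.ofReal_le_ofReal ?_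
      have h3 : 0 < max (w' x - k') 0 := hx
      have h4 : k' < w' x := by
        by_contra hcon
        rw [max_eq_right (by linarith)] at h3
        exact lt_irrefl _ h3
      exact pow_le_pow_left₀ (by linarith) ((by linarith : k' - k ≤ w' x - k).trans
        (le_max_left _ _)) 2
    exact hSr.trans (setLIntegral_le_lintegral _ _)
  have hSA : volume.real S ≤ A := by
    refine le_trans ?_ hAle
    rw [le_div_iff₀ hkk, mul_comm]
    rw [← ENNReal.ofReal_toReal hSfin, ← ENNReal.ofReal_mul hkk.le,
      ENNReal.ofReal_le_ofReal_iff (excess_nonneg _ _ _ _)] at hcheb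
    exact hcheb
  refine le_of_forall_pos_le_add fun ε hε => ?_
  have hc : 0 < C * A ^ δ := by positivity
  set η := ε / (C * A ^ δ) with hη
  have hη0 : 0 < η := by positivity
  have hge : gagliardo s p univ g ≤ ENNReal.ofReal √(X + η) := by
    rw [← gagliardo_congr_ae hwg]
    exact hgag.trans (ENNReal.ofReal_le_ofReal (Real.sqrt_le_sqrt (by linarith)))
  have hfinal := hS g hgm (fun x => trunc_nonneg _ _) A √(X + η) hA
    (Real.sqrt_pos.2 (by linarith)) hSfin hSV hSA hge
  rw [Real.sq_sqrt (by linarith)] at hfinal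
  have h5 : ENNReal.ofReal (excess Ω (fun t x => u t x - v t x) k' t) ≤
      ENNReal.ofReal (C * A ^ δ * (X + η)) := by
    rw [hint k' hk']
    exact (setLIntegral_le_lintegral _ _).trans hfinal
  rw [ENNReal.ofReal_le_ofReal_iff (by positivity)] at h5
  refine h5.trans (le_of_eq ?_)
  rw [hη]
  field_simp

theorem excess_antitone (h : EvolutionPair s p Ω t₀ t₁ M u v) (hp : 1 < p) (hp₂ : p < 2)
    (hM : 0 < M) {k : ℝ} (hk : 0 ≤ k) {a b : ℝ} (ha : a ∈ Icc t₀ t₁) (hb : b ∈ Icc t₀ t₁)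
    (hab : a ≤ b) :
    excess Ω (fun t x => u t x - v t x) k b ≤ excess Ω (fun t x => u t x - v t x) k a := by
  have hr := h.restrict ha hb
  have := sub_le_integral_of_deriv_le (φ := fun _ => 0) hab
    (fun c hc d hd hcd => hr.excess_sub_le_mul hp hM hk hc hd hcd) intervalIntegrable_const ?_
  · simpa using this
  filter_upwards [hr.deriv_excess_le hp hM hab hk, (ae_restrict_iff' measurableSet_Icc).1 hr.bound]
    with t h1 h2 ht d hd
  have h3 := (energy_trunc hp hp₂ hM hk (h2 (Ioo_subset_Icc_self ht))).1
  have hpos : 0 < M ^ (2 - p) / (p - 1) := div_pos (by positivity) (by linarith)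
  have h4 := nonneg_of_mul_nonneg_right h3 hpos
  linarith [h1 ht d hd]

/-- The gain between two levels and two times. On `[a, b]` the derivative of the excess above `k'`
is at most the constant `-excess k' b / Λ`, since the excess is nonincreasing in time and is
controlled by the energy with the factor `Λ`, which only involves the excess above `k` at time
`a`. -/
theorem excess_mul_le (h : EvolutionPair s p Ω t₀ t₁ M u v) (hp : 1 < p) (hp₂ : p < 2)
    (hM : 0 < M) (hΩ : MeasurableSet Ω) (hfin : volume Ω ≠ ∞) {V C δ : ℝ}
    (hV : volume.real Ω ≤ V) (hC : 0 < C) (hS : SupportSobolev n s p δ C V)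
    {k k' : ℝ} (hk : 0 ≤ k) (hkk' : k < k') {a b : ℝ} (ha : a ∈ Icc t₀ t₁) (hb : b ∈ Icc t₀ t₁)
    (hab : a ≤ b) :
    excess Ω (fun t x => u t x - v t x) k' b * (b - a) ≤
      C * (M ^ (2 - p) / (2 * (p - 1))) *
        (excess Ω (fun t x => u t x - v t x) k a / (k' - k) ^ 2) ^ δ *
          excess Ω (fun t x => u t x - v t x) k a := by
  set y := excess Ω (fun t x => u t x - v t x) with hy
  have hk' : 0 ≤ k' := hk.trans hkk'.le
  have hkk : 0 < (k' - k) ^ 2 := pow_pos (by linarith) 2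
  have hp1 : 0 < p - 1 := by linarith
  have hlevel : ∀ t ∈ Icc t₀ t₁, y k' t ≤ y k t := fun t ht =>
    h.cont.excess_anti hk hkk'.le ht
  rcases eq_or_lt_of_le (excess_nonneg Ω (fun t x => u t x - v t x) k a) with h0 | h0
  · have h1 : y k' b ≤ 0 := (h.excess_antitone hp hp₂ hM hk' ha hb hab).trans
      ((hlevel a ha).trans h0.ge)
    rw [hy, ← h0, mul_zero]
    exact mul_nonpos_of_nonpos_of_nonneg h1 (by linarith)
  set A := y k a / (k' - k) ^ 2 with hA
  have hA0 : 0 < A := div_pos h0 hkk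
  set Λ := C * (M ^ (2 - p) / (2 * (p - 1))) * A ^ δ with hΛ
  have hΛ0 : 0 < Λ := by positivity
  have hr := h.restrict ha hb
  have hmain := sub_le_integral_of_deriv_le (y := y k') (φ := fun _ => -(y k' b / Λ)) hab
    (fun c hc d hd hcd => hr.excess_sub_le_mul hp hM hk' hc hd hcd) intervalIntegrable_const ?_
  · rw [intervalIntegral.integral_const, smul_eq_mul] at hmain
    have h1 : (b - a) * (y k' b / Λ) ≤ y k a := by
      linarith [hlevel a ha, excess_nonneg Ω (fun t x => u t x - v t x) k' b]
    rw [mul_div_assoc', div_le_iff₀ hΛ0] at h1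
    linarith
  filter_upwards [hr.deriv_excess_le hp hM hab hk', (ae_restrict_iff' measurableSet_Icc).1
    (hr.excess_le_energy hp hp₂ hM hΩ hfin hV hC hS hk hkk')] with t h1 h2 ht d hd
  have htI := Ioo_subset_Icc_self ht
  have htI' : t ∈ Icc t₀ t₁ := ⟨ha.1.trans htI.1, htI.2.trans hb.2⟩
  have h3 := h2 htI A hA0 (by
    rw [hA]
    gcongr
    exact h.excess_antitone hp hp₂ hM hk ha htI' htI.1)
  have h4 := h1 ht d hd
  set B := energyForm s p (u t) (trunc k' fun x => u t x - v t x) -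
    energyForm s p (v t) (trunc k' fun x => u t x - v t x) with hB
  have h5 : y k' b ≤ y k' t := h.excess_antitone hp hp₂ hM hk' htI' hb htI.2
  have h6 : y k' b / Λ ≤ 2 * B := by
    rw [div_le_iff₀ hΛ0]
    refine h5.trans (h3.trans (le_of_eq ?_))
    rw [hΛ]
    field_simp
  linarith

end EvolutionPair

/-- De Giorgi's iteration along the levels `k (1 - 2^{-j})` and the times `T - τ 2^{-j}`: the
excess decreases like `ρ ^ j`. -/
theorem eq_zero_of_excess_mul_le {Y : ℝ → ℝ → ℝ} {δ Λ τ T Q k : ℝ} (hδ : 0 < δ) (hΛ : 0 < Λ)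
    (hτ : 0 < τ) (hk : 0 ≤ k) (hY : ∀ k t, 0 ≤ Y k t)
    (hlevel : ∀ k k', 0 ≤ k → k ≤ k' → Y k' T ≤ Y k T)
    (htime : ∀ k a b, 0 ≤ k → T - τ ≤ a → a ≤ b → b ≤ T → Y k b ≤ Y k a)
    (hstep : ∀ k k' a b, 0 ≤ k → k < k' → T - τ ≤ a → a ≤ b → b ≤ T →
      Y k' b * (b - a) ≤ Λ * (Y k a / (k' - k) ^ 2) ^ δ * Y k a)
    (hQ : Y 0 (T - τ) ≤ Q)
    (hkQ : k ^ 2 = 4 * (8 * 2 ^ (1 / δ)) ^ (1 / δ) * (Λ / τ) ^ (1 / δ) * Q) : Y k T = 0 := by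
  have hQ0 : 0 ≤ Q := (hY _ _).trans hQ
  rcases eq_or_lt_of_le hk with rfl | hk0
  · have hD : 0 < 4 * (8 * 2 ^ (1 / δ)) ^ (1 / δ) * (Λ / τ) ^ (1 / δ) := by positivity
    have hQz : Q = 0 := by
      rw [zero_pow two_ne_zero] at hkQ
      exact (mul_eq_zero.1 hkQ.symm).resolve_left hD.ne'
    exact le_antisymm ((htime 0 (T - τ) T le_rfl le_rfl (by linarith) le_rfl).trans
      (hQz ▸ hQ)) (hY _ _)
  set ρ : ℝ := (4 * 2 ^ (1 / δ))⁻¹ with hρ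
  have hρ0 : 0 < ρ := by positivity
  have h2δ : ((2 : ℝ) ^ (1 / δ)) ^ δ = 2 := by
    rw [← Real.rpow_mul zero_le_two, one_div_mul_cancel hδ.ne', Real.rpow_one]
  have hρδ : (4 * ρ) ^ δ = 2⁻¹ := by
    rw [hρ, mul_inv, mul_inv_cancel_left₀ (by norm_num), Real.inv_rpow (by positivity), h2δ]
  have hρ1 : ρ < 1 := by
    have : (1 : ℝ) ≤ 2 ^ (1 / δ) := Real.one_le_rpow one_le_two (by positivity)
    rw [hρ]
    exact inv_lt_one_of_one_lt₀ (by linarith)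
  -- the choice of `k` makes the first step of the iteration work
  have hkδ : Λ * (4 * Q / k ^ 2) ^ δ = τ * ρ / 2 := by
    have hQpos : 0 < Q := by
      rcases eq_or_lt_of_le hQ0 with h | h
      · rw [← h, mul_zero] at hkQ
        exact absurd hkQ (pow_pos hk0 2).ne'
      · exact h
    have h1 : 4 * Q / k ^ 2 = ((8 * 2 ^ (1 / δ) * (Λ / τ)) ^ (1 / δ))⁻¹ := by
      have hmr : (8 * 2 ^ (1 / δ) * (Λ / τ)) ^ (1 / δ) =
          (8 * 2 ^ (1 / δ)) ^ (1 / δ) * (Λ / τ) ^ (1 / δ) :=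
        Real.mul_rpow (by positivity) (by positivity)
      have hpos : 0 < (8 * 2 ^ (1 / δ) * (Λ / τ)) ^ (1 / δ) := by positivity
      rw [hkQ, mul_assoc 4, ← hmr, mul_right_comm 4, div_mul_cancel_left₀ (by positivity)]
    rw [h1, Real.inv_rpow (by positivity), ← Real.rpow_mul (by positivity),
      one_div_mul_cancel hδ.ne', Real.rpow_one, hρ]
    field_simp
    norm_num
  have hdecay : ∀ j : ℕ, Y (k * (1 - (2 ^ j)⁻¹)) (T - τ * (2 ^ j)⁻¹) ≤ Q * ρ ^ j := by
    intro j
    induction j with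
    | zero => simpa using hQ
    | succ j ih =>
      have hj : ((2 : ℝ) ^ j)⁻¹ ≤ 1 := inv_le_one_of_one_le₀ (one_le_pow₀ one_le_two)
      have hj0 : 0 < ((2 : ℝ) ^ j)⁻¹ := by positivity
      have hjs : ((2 : ℝ) ^ (j + 1))⁻¹ = (2 ^ j)⁻¹ / 2 := by
        rw [pow_succ, mul_inv]
        ring
      have h1 := hstep (k * (1 - (2 ^ j)⁻¹)) (k * (1 - (2 ^ (j + 1))⁻¹)) (T - τ * (2 ^ j)⁻¹)
        (T - τ * (2 ^ (j + 1))⁻¹) (mul_nonneg hk (by linarith)) (by rw [hjs]; gcongr; linarith)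
        (by nlinarith) (by rw [hjs]; nlinarith) (by rw [hjs]; nlinarith)
      set y := Y (k * (1 - (2 ^ j)⁻¹)) (T - τ * (2 ^ j)⁻¹) with hy
      have hy0 : 0 ≤ y := hY _ _
      have e1 : T - τ * (2 ^ (j + 1))⁻¹ - (T - τ * (2 ^ j)⁻¹) = τ / 2 * (2 ^ j)⁻¹ := by
        rw [hjs]
        ring
      have e2 : (k * (1 - (2 ^ (j + 1))⁻¹) - k * (1 - (2 ^ j)⁻¹)) ^ 2 = k ^ 2 / (4 * 4 ^ j) := by
        rw [hjs, show (4 : ℝ) ^ j = 2 ^ j * 2 ^ j by rw [← mul_pow]; norm_num]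
        field_simp
        ring
      rw [e1, e2] at h1
      have h2 : (y / (k ^ 2 / (4 * 4 ^ j))) ^ δ ≤ (4 * Q / k ^ 2) ^ δ * (2 ^ j)⁻¹ := by
        have e3 : ((2 : ℝ) ^ j)⁻¹ = ((4 * ρ) ^ j) ^ δ := by
          rw [← inv_pow, ← hρδ, Real.rpow_pow_comm (by positivity)]
        rw [e3, ← Real.mul_rpow (by positivity) (by positivity)]
        refine Real.rpow_le_rpow (by positivity) ?_ hδ.le
        calc y / (k ^ 2 / (4 * 4 ^ j)) ≤ Q * ρ ^ j / (k ^ 2 / (4 * 4 ^ j)) := by gcongr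
          _ = _ := by
            rw [mul_pow]
            field_simp
      have h3 : Λ * (y / (k ^ 2 / (4 * 4 ^ j))) ^ δ * y ≤
          Λ * ((4 * Q / k ^ 2) ^ δ * (2 ^ j)⁻¹) * (Q * ρ ^ j) := by gcongr
      have h4 := h1.trans h3
      have e4 : Λ * ((4 * Q / k ^ 2) ^ δ * (2 ^ j)⁻¹) * (Q * ρ ^ j) =
          Q * ρ ^ (j + 1) * (τ / 2 * (2 ^ j)⁻¹) := by
        rw [← mul_assoc Λ, hkδ, pow_succ]
        ring
      rw [e4] at h4
      exact le_of_mul_le_mul_right h4 (by positivity)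
  have hbound : ∀ j : ℕ, Y k T ≤ Q * ρ ^ j := fun j => by
    have hj : ((2 : ℝ) ^ j)⁻¹ ≤ 1 := inv_le_one_of_one_le₀ (one_le_pow₀ one_le_two)
    have hj0 : 0 < ((2 : ℝ) ^ j)⁻¹ := by positivity
    have hkj : 0 ≤ k * (1 - (2 ^ j)⁻¹) := mul_nonneg hk (by linarith)
    exact (hlevel _ k hkj (by nlinarith)).trans ((htime _ _ T hkj (by nlinarith)
      (by nlinarith) le_rfl).trans (hdecay j))
  have hlim : Tendsto (fun j : ℕ => Q * ρ ^ j) atTop (𝓝 0) := by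
    simpa using (tendsto_pow_atTop_nhds_zero_of_lt_one hρ0.le hρ1).const_mul Q
  exact le_antisymm (ge_of_tendsto' hlim hbound) (hY _ _)

/-! ### The smoothing estimate -/

namespace EvolutionPair

variable {n : ℕ} {s p : ℝ} {Ω : Set (E n)} {t₀ t₁ M : ℝ} {u v : ℝ → E n → ℝ}

theorem ae_sub_le (h : EvolutionPair s p Ω t₀ t₁ M u v) (hp : 1 < p) (hp₂ : p < 2)
    (hM : 0 < M) (hΩ : MeasurableSet Ω) (hfin : volume Ω ≠ ∞) {V C δ : ℝ}
    (hV : volume.real Ω ≤ V) (hC : 0 < C) (hδ : 0 < δ) (hS : SupportSobolev n s p δ C V)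
    {T τ k Q : ℝ} (hτ : 0 < τ) (hτT : t₀ ≤ T - τ) (hT : T ≤ t₁) (hk : 0 ≤ k)
    (hQ : excess Ω (fun t x => u t x - v t x) 0 (T - τ) ≤ Q)
    (hkQ : k ^ 2 = 4 * (8 * 2 ^ (1 / δ)) ^ (1 / δ) *
      (C * (M ^ (2 - p) / (2 * (p - 1))) / τ) ^ (1 / δ) * Q)
    {t : ℝ} (ht : t ∈ Icc T t₁) : ∀ᵐ x ∂(volume.restrict Ω), u t x - v t x ≤ k := by
  have hp1 : 0 < p - 1 := by linarith
  have hTI : T ∈ Icc t₀ t₁ := ⟨by linarith, hT⟩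
  have htI : t ∈ Icc t₀ t₁ := ⟨hTI.1.trans ht.1, ht.2⟩
  have hI : ∀ c, T - τ ≤ c → c ≤ T → c ∈ Icc t₀ t₁ := fun c h1 h2 =>
    ⟨hτT.trans h1, h2.trans hT⟩
  have hzero : excess Ω (fun t x => u t x - v t x) k T = 0 := by
    refine eq_zero_of_excess_mul_le hδ (by positivity) hτ hk
      (fun k t => excess_nonneg _ _ k t) (fun k k' hk hkk' => h.cont.excess_anti hk hkk' hTI)
      (fun k a b hk ha hab hb => h.excess_antitone hp hp₂ hM hk (hI a ha (hab.trans hb))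
        (hI b (ha.trans hab) hb) hab)
      (fun k k' a b hk hkk' ha hab hb => h.excess_mul_le hp hp₂ hM hΩ hfin hV hC hS hk hkk'
        (hI a ha (hab.trans hb)) (hI b (ha.trans hab) hb) hab) hQ hkQ
  have hzero' : excess Ω (fun t x => u t x - v t x) k t = 0 :=
    le_antisymm (hzero ▸ h.excess_antitone hp hp₂ hM hk hTI htI ht.1) (excess_nonneg _ _ _ _)
  rw [excess, integral_eq_zero_iff_of_nonneg (fun x => sq_nonneg _)
    (h.cont.integrable_sq_trunc hk htI)] at hzero'
  filter_upwards [hzero'] with x hx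
  have h1 : trunc k (fun x => u t x - v t x) x = 0 := pow_eq_zero_iff two_ne_zero |>.1 hx
  have h2 := max_eq_right_iff.1 h1
  linarith

/-- The bound in terms of the `L²` norm at one earlier time: `ae_sub_le` is applied to `u - v` and
to `v - u`. -/
theorem eLpNorm_top_sq_le (h : EvolutionPair s p Ω t₀ t₁ M u v) (hp : 1 < p) (hp₂ : p < 2)
    (hM : 0 < M) (hΩ : MeasurableSet Ω) (hfin : volume Ω ≠ ∞) {V C δ : ℝ}
    (hV : volume.real Ω ≤ V) (hC : 0 < C) (hδ : 0 < δ) (hS : SupportSobolev n s p δ C V)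
    {T τ Q : ℝ} (hτ : 0 < τ) (hτT : t₀ ≤ T - τ) (hT : T ≤ t₁)
    (hQ : ∫ x in Ω, (u (T - τ) x - v (T - τ) x) ^ 2 = Q) {t : ℝ} (ht : t ∈ Icc T t₁) :
    eLpNorm (fun x => u t x - v t x) ∞ (volume.restrict Ω) ^ 2 ≤
      ENNReal.ofReal (4 * (8 * 2 ^ (1 / δ)) ^ (1 / δ) *
        (C * (M ^ (2 - p) / (2 * (p - 1))) / τ) ^ (1 / δ) * Q) := by
  have hp1 : 0 < p - 1 := by linarith
  have hmem : T - τ ∈ Icc t₀ t₁ := ⟨hτT, by linarith⟩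
  have hle : ∀ a b : ℝ, trunc 0 (fun x : ℝ => x) (a - b) ^ 2 ≤ (a - b) ^ 2 := fun a b => by
    rw [← sq_abs, ← sq_abs (a - b)]
    exact pow_le_pow_left₀ (abs_nonneg _) (abs_trunc_le (fun x : ℝ => x) le_rfl _) 2
  have hQ1 : excess Ω (fun t x => u t x - v t x) 0 (T - τ) ≤ Q := by
    rw [← hQ]
    exact integral_mono (h.cont.integrable_sq_trunc le_rfl hmem)
      (h.cont.memLp hmem).integrable_sq fun x => hle _ _
  have hQ2 : excess Ω (fun t x => v t x - u t x) 0 (T - τ) ≤ Q := by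
    rw [← hQ]
    exact integral_mono (h.symm.cont.integrable_sq_trunc le_rfl hmem)
      (h.cont.memLp hmem).integrable_sq fun x => (hle _ _).trans_eq (by ring)
  have hQ0 : 0 ≤ Q := (excess_nonneg _ _ _ _).trans hQ1
  set R := 4 * (8 * 2 ^ (1 / δ)) ^ (1 / δ) *
        (C * (M ^ (2 - p) / (2 * (p - 1))) / τ) ^ (1 / δ) * Q with hR
  have hR0 : 0 ≤ R := by positivity
  have h1 := h.ae_sub_le hp hp₂ hM hΩ hfin hV hC hδ hS hτ hτT hT (Real.sqrt_nonneg R) hQ1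
    (Real.sq_sqrt hR0) ht
  have h2 := h.symm.ae_sub_le hp hp₂ hM hΩ hfin hV hC hδ hS hτ hτT hT (Real.sqrt_nonneg R) hQ2
    (Real.sq_sqrt hR0) ht
  have h3 : eLpNorm (fun x => u t x - v t x) ∞ (volume.restrict Ω) ≤ ENNReal.ofReal √R := by
    rw [eLpNorm_exponent_top]
    refine eLpNormEssSup_le_of_ae_bound ?_
    filter_upwards [h1, h2] with x hx hx'
    exact abs_le.2 ⟨by linarith, hx⟩
  calc _ ≤ ENNReal.ofReal √R ^ 2 := by gcongr
    _ = ENNReal.ofReal R := by rw [← ENNReal.ofReal_pow (Real.sqrt_nonneg R), Real.sq_sqrt hR0]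

theorem integral_sq_antitone (h : EvolutionPair s p Ω t₀ t₁ M u v) (hp : 1 < p) (hp₂ : p < 2)
    (hM : 0 < M) {a b : ℝ} (ha : a ∈ Icc t₀ t₁) (hb : b ∈ Icc t₀ t₁) (hab : a ≤ b) :
    ∫ x in Ω, (u b x - v b x) ^ 2 ≤ ∫ x in Ω, (u a x - v a x) ^ 2 := by
  have key : ∀ t ∈ Icc t₀ t₁, ∫ x in Ω, (u t x - v t x) ^ 2 =
      excess Ω (fun t x => u t x - v t x) 0 t + excess Ω (fun t x => v t x - u t x) 0 t := by
    intro t ht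
    rw [excess, excess, ← integral_add (h.cont.integrable_sq_trunc le_rfl ht)
      (h.symm.cont.integrable_sq_trunc le_rfl ht)]
    congr 1 with x
    simp only [trunc, sub_zero]
    rcases le_total (u t x) (v t x) with hx | hx
    · rw [max_eq_right (by linarith), max_eq_left (by linarith)]
      ring
    · rw [max_eq_left (by linarith), max_eq_right (by linarith)]
      ring
  rw [key a ha, key b hb]
  exact add_le_add (h.excess_antitone hp hp₂ hM le_rfl ha hb hab)
    (h.symm.excess_antitone hp hp₂ hM le_rfl ha hb hab)

theorem ofReal_mul_le_lintegral (h : EvolutionPair s p Ω t₀ t₁ M u v) (hp : 1 < p) (hp₂ : p < 2)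
    (hM : 0 < M) {b : ℝ} (hb : b ∈ Icc t₀ t₁) :
    ENNReal.ofReal (∫ x in Ω, (u b x - v b x) ^ 2) * ENNReal.ofReal (b - t₀) ≤
      ∫⁻ t in Icc t₀ t₁, ∫⁻ x in Ω, ‖u t x - v t x‖ₑ ^ 2 := by
  have hsub : Icc t₀ b ⊆ Icc t₀ t₁ := Icc_subset_Icc_right hb.2
  refine le_trans ?_ (lintegral_mono_set hsub)
  rw [← Real.volume_Icc, ← setLIntegral_const]
  refine setLIntegral_mono' measurableSet_Icc fun t ht => ?_
  refine (ENNReal.ofReal_le_ofReal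
    (h.integral_sq_antitone hp hp₂ hM (hsub ht) hb ht.2)).trans (le_of_eq ?_)
  rw [ofReal_integral_eq_lintegral_ofReal (h.cont.memLp (hsub ht)).integrable_sq
    (Eventually.of_forall fun x => sq_nonneg _)]
  refine lintegral_congr fun x => ?_
  rw [Real.enorm_eq_ofReal_abs, ← ENNReal.ofReal_pow (abs_nonneg _), sq_abs]

end EvolutionPair

theorem ae_gagliardo_le {n : ℕ} {s p : ℝ} (hp : 0 < p) {u : ℝ → E n → ℝ} {J : Set ℝ}
    (h : MemLpTime (MemW s p univ) (sobolevNorm s p univ) ∞ J u) :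
    ∃ a : ℝ≥0∞, a < ∞ ∧ ∀ᵐ t ∂(volume.restrict J), gagliardo s p univ (u t) ≤ a := by
  refine ⟨_, h.2.2, ?_⟩
  rw [eLpNorm_exponent_top, eLpNormEssSup]
  filter_upwards [ENNReal.ae_le_essSup (μ := volume.restrict J)
    fun t => ‖sobolevNorm s p univ (u t)‖ₑ] with t ht
  exact (gagliardo_le_sobolevNorm hp univ (u t)).trans ht

/-- The constant of the smoothing estimate, in terms of the constant `C` and the exponent `δ` of the
Sobolev inequality for functions of small support. -/
noncomputable def smoothingConst (p δ C : ℝ) : ℝ :=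
  16 * (8 * 2 ^ (1 / δ)) ^ (1 / δ) * (2 * C / (p - 1)) ^ (1 / δ)

theorem smoothingConst_pos {p δ C : ℝ} (hp : 1 < p) (hC : 0 < C) : 0 < smoothingConst p δ C := by
  have : 0 < p - 1 := by linarith
  unfold smoothingConst
  positivity

/-- The `L² → L^∞` smoothing estimate, with the exponent `1 / δ` of the Sobolev inequality for
functions of small support. -/
theorem smoothing_estimate {n : ℕ} {s p : ℝ} (hp : 1 < p) (hp₂ : p < 2) {C δ V : ℝ}
    (hC : 0 < C) (hδ : 0 < δ) (hS : SupportSobolev n s p δ C V) {Ω Ω' : Set (E n)}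
    (hΩ : MeasurableSet Ω) (hb : Bornology.IsBounded Ω) (hV : volume.real Ω ≤ V)
    {f : ℝ → X0Functional s p Ω Ω'} {u v : ℝ → E n → ℝ}
    (hu : IsWeakSolution s p Ω Ω' (Ioi 0) f u) (hv : IsWeakSolution s p Ω Ω' (Ioi 0) f v)
    (hub : MemLpTimeLoc (MemW s p univ) (sobolevNorm s p univ) ∞ (Ioi 0) u)
    (hvb : MemLpTimeLoc (MemW s p univ) (sobolevNorm s p univ) ∞ (Ioi 0) v)
    (hw : MemLpTimeLoc (MemW0 s p Ω) (sobolevNorm s p univ) (ENNReal.ofReal p) (Ioi 0)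
      (fun t x => u t x - v t x)) {T t₂ : ℝ} (hT : 0 < T) (hTt : T < t₂) :
    (⨆ t ∈ Icc T t₂, eLpNorm (fun x => u t x - v t x) ∞ (volume.restrict Ω) ^ 2) ≤
      ENNReal.ofReal (smoothingConst p δ C) *
        (ENNReal.ofReal (T ^ (-(1 / δ) - 1)) / Lconst s p (T / 2) t₂ u v ^ (1 / δ)) *
        ∫⁻ t in Icc (T / 2) t₂, ∫⁻ x in Ω, ‖u t x - v t x‖ₑ ^ 2 := by
  rw [smoothingConst]
  have hp0 : 0 < p := by linarith
  have hp1 : 0 < p - 1 := by linarith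
  have hp2 : 0 < 2 - p := by linarith
  have h01 : T / 2 < t₂ := by linarith
  have hsub : Icc (T / 2) t₂ ⊆ Ioi 0 := fun x hx => (by positivity : 0 < T / 2).trans_le hx.1
  have hfin : volume Ω ≠ ∞ := hb.measure_lt_top.ne
  set β := 1 / δ with hβ
  have hβ0 : 0 < β := by positivity
  set m : ℝ≥0∞ := essSup (fun τ => gagliardo s p univ (v τ) + gagliardo s p univ (u τ))
    (volume.restrict (Icc (T / 2) t₂)) with hm
  have hm_top : m < ∞ := by
    obtain ⟨a, ha, hua⟩ := ae_gagliardo_le hp0 (hub _ _ h01 hsub)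
    obtain ⟨b, hb, hvb⟩ := ae_gagliardo_le hp0 (hvb _ _ h01 hsub)
    refine lt_of_le_of_lt (essSup_le_of_ae_le (b + a) ?_) (ENNReal.add_lt_top.2 ⟨hb, ha⟩)
    filter_upwards [hua, hvb] with t h1 h2
    exact add_le_add h2 h1
  have hpair : ∀ M : ℝ, m ≤ ENNReal.ofReal M → EvolutionPair s p Ω (T / 2) t₂ M u v := by
    intro M hM
    refine evolutionPair_of_isWeakSolution hp hΩ hb hu hv hw (by positivity) h01 ?_
    filter_upwards [(hub _ _ h01 hsub).1, (hvb _ _ h01 hsub).1,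
      ENNReal.ae_le_essSup (μ := volume.restrict (Icc (T / 2) t₂))
        fun τ => gagliardo s p univ (v τ) + gagliardo s p univ (u τ)] with t h1 h2 h3
    exact ⟨h1, h2, by rw [add_comm]; exact h3.trans hM⟩
  set Q := ∫ x in Ω, (u (T - T / 4) x - v (T - T / 4) x) ^ 2 with hQ
  have hQ0 : 0 ≤ Q := integral_nonneg fun _ => sq_nonneg _
  set K := 4 * (8 * 2 ^ β) ^ β * (2 * C / (p - 1)) ^ β with hK
  have hK0 : 0 < K := by positivity
  have hsup : ∀ M : ℝ, 0 < M → m ≤ ENNReal.ofReal M → ∀ t ∈ Icc T t₂,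
      eLpNorm (fun x => u t x - v t x) ∞ (volume.restrict Ω) ^ 2 ≤
        ENNReal.ofReal (K * T ^ (-β) * (M ^ (2 - p)) ^ β * Q) := by
    intro M hM hmM t ht
    refine ((hpair M hmM).eLpNorm_top_sq_le hp hp₂ hM hΩ hfin hV hC hδ hS
      (by positivity : 0 < T / 4) (by linarith) hTt.le hQ.symm ht).trans (le_of_eq ?_)
    rw [← hβ, hK, Real.rpow_neg hT.le, show C * (M ^ (2 - p) / (2 * (p - 1))) / (T / 4) =
        2 * C / (p - 1) * M ^ (2 - p) / T by field_simp; ring,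
      Real.div_rpow (by positivity) hT.le,
      Real.mul_rpow (x := 2 * C / (p - 1)) (by positivity) (by positivity)]
    congr 1
    ring
  refine iSup₂_le fun t ht => ?_
  rcases eq_or_ne m 0 with h0 | h0
  · -- here `u - v` vanishes: every `M > 0` is admissible, and `M` may tend to zero
    have hlim : Tendsto (fun M : ℝ => ENNReal.ofReal (K * T ^ (-β) * (M ^ (2 - p)) ^ β * Q))
        (𝓝[>] 0) (𝓝 0) := by
      have hc : Continuous fun M : ℝ => ENNReal.ofReal (K * T ^ (-β) * (M ^ (2 - p)) ^ β * Q) :=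
        ENNReal.continuous_ofReal.comp ((continuous_const.mul
          ((Real.continuous_rpow_const hβ0.le).comp
            (Real.continuous_rpow_const hp2.le))).mul continuous_const)
      have := (hc.tendsto 0).mono_left (nhdsWithin_le_nhds (s := Ioi 0))
      simpa [Real.zero_rpow hp2.ne', Real.zero_rpow hβ0.ne'] using this
    refine le_trans (ge_of_tendsto hlim ?_) zero_le
    filter_upwards [self_mem_nhdsWithin] with M hM
    exact hsup M hM (by rw [h0]; exact zero_le) t ht
  · have hM : 0 < m.toReal := ENNReal.toReal_pos h0 hm_top.ne
    set M := m.toReal with hMdef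
    have hmM : m = ENNReal.ofReal M := (ENNReal.ofReal_toReal hm_top.ne).symm
    have hL : ENNReal.ofReal (T ^ (-β - 1)) / Lconst s p (T / 2) t₂ u v ^ β =
        ENNReal.ofReal (T ^ (-β - 1) * (M ^ (2 - p)) ^ β) := by
      rw [Lconst, ← hm, hmM, ENNReal.ofReal_rpow_of_pos hM,
        ENNReal.ofReal_rpow_of_pos (by positivity), ← ENNReal.ofReal_div_of_pos (by positivity),
        show p - 2 = -(2 - p) by ring, Real.rpow_neg hM.le, Real.inv_rpow (by positivity),
        div_inv_eq_mul]
    rw [hL]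
    have hX := (hpair M hmM.le).ofReal_mul_le_lintegral hp hp₂ hM
      (b := T - T / 4) ⟨by linarith, by linarith⟩
    rw [← hQ] at hX
    refine le_trans ?_ (mul_le_mul_right hX _)
    rw [← ENNReal.ofReal_mul hQ0, ← ENNReal.ofReal_mul (by positivity),
      ← ENNReal.ofReal_mul (by positivity)]
    refine (hsup M hM hmM.le t ht).trans (ENNReal.ofReal_le_ofReal (le_of_eq ?_))
    rw [Real.rpow_sub_one hT.ne', hK]
    field_simp
    ring

/-- With `θ = sp / N`, the condition `ν < p` says that the exponent `δ` of the Sobolev inequality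
for functions of small support is positive; its inverse is the power of `L` in the estimate. -/
theorem exponents {s p N ν : ℝ} (hs : 0 < s) (hp : 1 < p) (hN : s * p < N)
    (hν : ν = 2 * N / (N + 2 * s)) (hνp : ν < p) :
    2 < p / (1 - s * p / N) ∧ 0 < 1 - 2 * (1 - s * p / N) / p ∧
      p * ν / (2 * (p - ν)) = 1 / (1 - 2 * (1 - s * p / N) / p) ∧
      ((2 - p) * ν - 2 * p) / (2 * (p - ν)) = -(1 / (1 - 2 * (1 - s * p / N) / p)) - 1 := by
  have hp0 : 0 < p := by linarith
  have hsp : 0 < s * p := by positivity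
  have hN0 : 0 < N := hsp.trans hN
  have hNs : 0 < N + 2 * s := by positivity
  have h1 : 0 < p * (N + 2 * s) - 2 * N := by
    rw [hν, div_lt_iff₀ hNs] at hνp
    linarith
  have hθ : 0 < 1 - s * p / N := by
    rw [sub_pos, div_lt_one hN0]
    exact hN
  have e1 : 1 - 2 * (1 - s * p / N) / p = (p * (N + 2 * s) - 2 * N) / (p * N) := by
    field_simp
    ring
  have e2 : p - ν = (p * (N + 2 * s) - 2 * N) / (N + 2 * s) := by
    rw [hν]
    field_simp
  have hδ : 0 < 1 - 2 * (1 - s * p / N) / p := by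
    rw [e1]
    positivity
  refine ⟨?_, hδ, ?_, ?_⟩
  · rw [lt_div_iff₀ hθ]
    have : 2 * (1 - s * p / N) / p < 1 := by linarith
    rwa [div_lt_one hp0] at this
  · rw [e1, e2, hν]
    field_simp
  · rw [e1, e2, hν]
    field_simp
    ring

end FracPLap

theorem mainTheorem6 (n : ℕ) (hn : 0 < n) (s p : ℝ) (hs₀ : 0 < s) (hs₁ : s < 1)
    (hp : max 1 (2 * (n : ℝ) / (n + 2 * s)) < p) (hp₂ : p < 2) :
    (s * p < n →
      ∀ ν : ℝ, ν = 2 * (n : ℝ) / (n + 2 * s) →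
      ∃ C : ℝ, 0 < C ∧
        ∀ Ω : Set (FracPLap.E n), IsOpen Ω → IsConnected Ω → Bornology.IsBounded Ω →
        ∀ Ω' : Set (FracPLap.E n), IsOpen Ω' → Bornology.IsBounded Ω' → closure Ω ⊆ Ω' →
        ∀ f : ℝ → FracPLap.X0Functional s p Ω Ω', FracPLap.MemSource s p Ω Ω' (Ioi 0) f →
        ∀ u v : ℝ → FracPLap.E n → ℝ,
          FracPLap.IsWeakSolution s p Ω Ω' (Ioi 0) f u →
          FracPLap.IsWeakSolution s p Ω Ω' (Ioi 0) f v →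
          FracPLap.MemLpTimeLoc (FracPLap.MemW s p univ) (FracPLap.sobolevNorm s p univ)
            ∞ (Ioi 0) u →
          FracPLap.MemLpTimeLoc (FracPLap.MemW s p univ) (FracPLap.sobolevNorm s p univ)
            ∞ (Ioi 0) v →
          FracPLap.MemLpTimeLoc (FracPLap.MemW0 s p Ω) (FracPLap.sobolevNorm s p univ)
            (ENNReal.ofReal p) (Ioi 0) (fun t x => u t x - v t x) →
        ∀ T t₂ : ℝ, 0 < T → T < t₂ → t₂ < 3 * T / 2 →
          (⨆ t ∈ Icc T t₂, eLpNorm (fun x => u t x - v t x) ∞ (volume.restrict Ω) ^ 2)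
            ≤ ENNReal.ofReal C
              * (ENNReal.ofReal (T ^ (((2 - p) * ν - 2 * p) / (2 * (p - ν))))
                / FracPLap.Lconst s p (T / 2) t₂ u v ^ (p * ν / (2 * (p - ν))))
              * ∫⁻ t in Icc (T / 2) t₂, ∫⁻ x in Ω, ‖u t x - v t x‖ₑ ^ 2) ∧
    ((n : ℝ) ≤ s * p →
      ∀ N : ℝ, s * p < N →
      ∀ ν : ℝ, ν = 2 * N / (N + 2 * s) → ν < p →
      ∀ Ω : Set (FracPLap.E n), IsOpen Ω → IsConnected Ω → Bornology.IsBounded Ω →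
      ∃ C : ℝ, 0 < C ∧
        ∀ Ω' : Set (FracPLap.E n), IsOpen Ω' → Bornology.IsBounded Ω' → closure Ω ⊆ Ω' →
        ∀ f : ℝ → FracPLap.X0Functional s p Ω Ω', FracPLap.MemSource s p Ω Ω' (Ioi 0) f →
        ∀ u v : ℝ → FracPLap.E n → ℝ,
          FracPLap.IsWeakSolution s p Ω Ω' (Ioi 0) f u →
          FracPLap.IsWeakSolution s p Ω Ω' (Ioi 0) f v →
          FracPLap.MemLpTimeLoc (FracPLap.MemW s p univ) (FracPLap.sobolevNorm s p univ)
            ∞ (Ioi 0) u →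
          FracPLap.MemLpTimeLoc (FracPLap.MemW s p univ) (FracPLap.sobolevNorm s p univ)
            ∞ (Ioi 0) v →
          FracPLap.MemLpTimeLoc (FracPLap.MemW0 s p Ω) (FracPLap.sobolevNorm s p univ)
            (ENNReal.ofReal p) (Ioi 0) (fun t x => u t x - v t x) →
        ∀ T t₂ : ℝ, 0 < T → T < t₂ → t₂ < 3 * T / 2 →
          (⨆ t ∈ Icc T t₂, eLpNorm (fun x => u t x - v t x) ∞ (volume.restrict Ω) ^ 2)
            ≤ ENNReal.ofReal C
              * (ENNReal.ofReal (T ^ (((2 - p) * ν - 2 * p) / (2 * (p - ν))))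
                / FracPLap.Lconst s p (T / 2) t₂ u v ^ (p * ν / (2 * (p - ν))))
              * ∫⁻ t in Icc (T / 2) t₂, ∫⁻ x in Ω, ‖u t x - v t x‖ₑ ^ 2) := by
  have hp1 : 1 < p := (le_max_left _ _).trans_lt hp
  have hp0 : 0 < p := by linarith
  have hn' : (0 : ℝ) < n := by exact_mod_cast hn
  have hsp : 0 < s * p := by positivity
  refine ⟨fun hspn ν hν => ?_, fun hnsp N hN ν hν hνp Ω hΩ _ hb => ?_⟩
  · obtain ⟨h2, hδ, e1, e2⟩ := FracPLap.exponents hs₀ hp1 hspn hν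
      (hν ▸ (le_max_right _ _).trans_lt hp)
    obtain ⟨κ, hκ, hK⟩ := FracPLap.exists_kernelBound hn hsp
    obtain ⟨C, hC, hS⟩ := FracPLap.exists_supportSobolev hp0 (div_pos hsp hn')
      ((div_lt_one hn').2 hspn) h2 hκ
    refine ⟨_, FracPLap.smoothingConst_pos (δ := 1 - 2 * (1 - s * p / n) / p) hp1 hC,
      fun Ω hΩ _ hb Ω' _ _ _ f _ u v hu hv hub hvb hw T t₂ hT hTt _ => ?_⟩
    rw [e1, e2]
    exact FracPLap.smoothing_estimate hp1 hp₂ hC hδ (hS n s _ (hK _)) hΩ.measurableSet hb le_rfl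
      hu hv hub hvb hw hT hTt
  · have hN0 : 0 < N := hsp.trans hN
    obtain ⟨h2, hδ, e1, e2⟩ := FracPLap.exponents hs₀ hp1 hN hν hνp
    have hV : 0 < volume.real Ω + 1 := by positivity
    obtain ⟨κ, hκ, hK⟩ := FracPLap.exists_kernelBound_of_le hn hsp (hnsp.trans hN.le) hV
    obtain ⟨C, hC, hS⟩ := FracPLap.exists_supportSobolev hp0 (div_pos hsp hN0)
      ((div_lt_one hN0).2 hN) h2 hκ
    refine ⟨_, FracPLap.smoothingConst_pos (δ := 1 - 2 * (1 - s * p / N) / p) hp1 hC,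
      fun Ω' _ _ _ f _ u v hu hv hub hvb hw T t₂ hT hTt _ => ?_⟩
    rw [e1, e2]
    exact FracPLap.smoothing_estimate hp1 hp₂ hC hδ (hS n s _ hK) hΩ.measurableSet hb
      (by linarith) hu hv hub hvb hw hT hTt
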